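/- Let $f\colon\mathbb{R}^n\to\mathbb{R}^n$ be smooth ($C^\infty$), and assume that its Jacobian is symmetric everywhere: $f_x(x)=f_x(x)^*$ for all $x\in\mathbb{R}^n$. Let $a$ and $b$ be hyperbolic equilibria of $\dot x=f(x)$ whose stable manifold $W^{\mathrm s}(a)$ and unstable manifold $W^{\mathrm u}(b)$ have dimensions $\dim W^{\mathrm s}(a)=n$ and $\dim W^{\mathrm u}(b)=1$. Let $h\colon\mathbb{R}\to\mathbb{R}^n$ be a solution of $\dot x=f(x)$ such that $h(0)\in W^{\mathrm u}(b)\cap W^{\mathrm s}(a)$ and the intersection is transverse at $h(0)$, that is, $T_{h(0)}W^{\mathrm u}(b)+T_{h(0)}W^{\mathrm s}(a)=\mathbb{R}^n$. Consider the system $$\dot u=-f(u)+v,\qquad \dot v=f_u(u)^*v,\qquad (u,v)\in\mathbb{R}^n\times\mathbb{R}^n,$$ and the function $H(u,v)=\tfrac12|v|^2-\langle f(u),v\rangle$. Then: (i) $(a,0)$ and $(b,0)$ are hyperbolic saddle equilibria of this system: $n\ge 1$, and at each of the two points the linearization has $n$ eigenvalues (counted with algebraic multiplicity) with negative real part and $n$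 with positive real part, and none on the imaginary axis; the stable and the unstable manifold of each of the two points are smooth injectively immersed manifolds of dimension $n$. (ii) $(u_*,v_*)(t):=(h(-t),0)$ is a solution of the system on $\mathbb{R}$. For every $t\in\mathbb{R}$, in particular for $t=0$, the point $p=(u_*,v_*)(t)$ lies in $W^{\mathrm u}(a,0)\cap W^{\mathrm s}(b,0)$, and this intersection is transverse at $p$ inside the level set $H^{-1}(0)$: both $W^{\mathrm u}(a,0)$ and $W^{\mathrm s}(b,0)$ are contained in $H^{-1}(0)$, the level set $H^{-1}(0)$ is near $p$ a smooth embedded submanifold of dimension $2n-1$, and $T_pW^{\mathrm u}(a,0)+T_pW^{\mathrm s}(b,0)=T_pH^{-1}(0)$. -/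

import Mathlib

open Filter Topology Set
open scoped ContDiff Pointwise InnerProductSpace

noncomputable section

namespace EscapePath

section General

variable {E : Type*} [NormedAddCommGroup E] [NormedSpace ℝ E]

/-- `S` is, near its point `q`, a smooth embedded submanifold of dimension `k`: a smooth
diffeomorphism `Φ` of a neighbourhood of `q` onto an open set flattens `S` to a `k`-dimensional
linear subspace. -/
def IsSubmanifoldAt (k : ℕ) (S : Set E) (q : E) : Prop :=
  q ∈ S ∧ ∃ (Φ : OpenPartialHomeomorph E E) (V : Submodule ℝ E),
    q ∈ Φ.source ∧ ContDiffOn ℝ ∞ Φ Φ.source ∧ ContDiffOn ℝ ∞ Φ.symm Φ.target ∧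
    Module.finrank ℝ V = k ∧ ∀ x ∈ Φ.source, x ∈ S ↔ Φ x ∈ V

/-- `S` is a smooth embedded submanifold of dimension `k`. -/
def IsSubmanifold (k : ℕ) (S : Set E) : Prop :=
  ∀ q ∈ S, IsSubmanifoldAt k S q

/-- The tangent space of `S` at `p`: velocities at `p` of smooth curves that run in `S`. -/
def tangentSet (S : Set E) (p : E) : Set E :=
  {v | ∃ γ : ℝ → E, ContDiffAt ℝ ∞ γ 0 ∧ γ 0 = p ∧ HasDerivAt γ v 0 ∧ ∀ᶠ s in 𝓝 0, γ s ∈ S}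

/-- `x` is a solution on `[0, ∞)` of `ẋ = F(x)` that starts at `p` and converges to `e`. -/
def IsConvergingSolution (F : E → E) (e p : E) (x : ℝ → E) : Prop :=
  IsIntegralCurveOn x (fun _ => F) (Ici 0) ∧ x 0 = p ∧ Tendsto x atTop (𝓝 e)

/-- The (global) stable manifold `Wˢ(e)` of `ẋ = F(x)`, as a set. -/
def stableSet (F : E → E) (e : E) : Set E :=
  {p | ∃ x : ℝ → E, IsConvergingSolution F e p x}

/-- The `ε`-plaque of `Wˢ(e)` around `p`: the points of `Wˢ(e)` whose forward orbit stays
`ε`-close to that of `p`. The plaques are a neighbourhood basis for the intrinsic topology of the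
immersed manifold `Wˢ(e)`, which is in general finer than the topology induced from `E`. -/
def stablePlaque (F : E → E) (e p : E) (ε : ℝ) : Set E :=
  {q | ∃ x y : ℝ → E, IsConvergingSolution F e p x ∧ IsConvergingSolution F e q y ∧
    ∀ t, 0 ≤ t → dist (x t) (y t) < ε}

/-- `Wˢ(e)` is a smooth (injectively immersed) manifold of dimension `k`: all sufficiently small
plaques are embedded `k`-dimensional submanifolds. -/
def StableManifoldHasDim (F : E → E) (e : E) (k : ℕ) : Prop :=
  ∀ p ∈ stableSet F e, ∀ᶠ ε in 𝓝[>] (0 : ℝ), IsSubmanifold k (stablePlaque F e p ε)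

/-- The tangent space `T_p Wˢ(e)`: vectors tangent at `p` to every plaque of `Wˢ(e)` around `p`. -/
def stableTangent (F : E → E) (e p : E) : Set E :=
  {v | ∀ ε : ℝ, 0 < ε → v ∈ tangentSet (stablePlaque F e p ε) p}

/-- The unstable manifold `Wᵘ(e)` of `ẋ = F(x)`, as a set: the stable manifold for reversed time,
that is, for `ẏ = -F(y)`. -/
def unstableSet (F : E → E) (e : E) : Set E :=
  stableSet (fun x => -F x) e

/-- `Wᵘ(e)` is a smooth (injectively immersed) manifold of dimension `k`. -/
def UnstableManifoldHasDim (F : E → E) (e : E) (k : ℕ) : Prop :=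
  StableManifoldHasDim (fun x => -F x) e k

/-- The tangent space `T_p Wᵘ(e)`. -/
def unstableTangent (F : E → E) (e p : E) : Set E :=
  stableTangent (fun x => -F x) e p

/-- `p ∈ Wᵘ(e₁) ⋔ Wˢ(e₂)` inside `M`: both manifolds lie in `M`, `p` lies on both of them, and
their tangent spaces at `p` together span the tangent space of `M`. -/
structure TransverseInside (F : E → E) (e₁ e₂ : E) (M : Set E) (p : E) : Prop where
  unstable_subset : unstableSet F e₁ ⊆ M
  stable_subset : stableSet F e₂ ⊆ M
  mem_unstable : p ∈ unstableSet F e₁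
  mem_stable : p ∈ stableSet F e₂
  tangent_sum : unstableTangent F e₁ p + stableTangent F e₂ p = tangentSet M p

/-- The complex eigenvalues of the Jacobian of `F` at `e`, with algebraic multiplicity. -/
def eigenvaluesAt [FiniteDimensional ℝ E] (F : E → E) (e : E) : Multiset ℂ :=
  (LinearMap.charpoly (fderiv ℝ F e : E →ₗ[ℝ] E)).aroots ℂ

/-- `e` is a hyperbolic equilibrium of `ẋ = F(x)`: no eigenvalue lies on the imaginary axis. -/
def IsHyperbolicEquilibrium [FiniteDimensional ℝ E] (F : E → E) (e : E) : Prop :=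
  F e = 0 ∧ ∀ z ∈ eigenvaluesAt F e, z.re ≠ 0

/-- Number of eigenvalues in the open left half-plane. -/
def stableIndex [FiniteDimensional ℝ E] (F : E → E) (e : E) : ℕ :=
  ((eigenvaluesAt F e).filter (fun z => z.re < 0)).card

/-- Number of eigenvalues in the open right half-plane. -/
def unstableIndex [FiniteDimensional ℝ E] (F : E → E) (e : E) : ℕ :=
  ((eigenvaluesAt F e).filter (fun z => 0 < z.re)).card

end General

section EulerLagrange

variable {n : ℕ}

/-- The Euler–Lagrange vector field `u̇ = -f(u) + v`, `v̇ = f_u(u)* v`. -/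
def elField (f : EuclideanSpace ℝ (Fin n) → EuclideanSpace ℝ (Fin n)) :
    EuclideanSpace ℝ (Fin n) × EuclideanSpace ℝ (Fin n) →
      EuclideanSpace ℝ (Fin n) × EuclideanSpace ℝ (Fin n) :=
  fun p => (-f p.1 + p.2, ContinuousLinearMap.adjoint (fderiv ℝ f p.1) p.2)

/-- The Hamiltonian `H(u, v) = |v|² / 2 - ⟨f(u), v⟩`. -/
def hamiltonian (f : EuclideanSpace ℝ (Fin n) → EuclideanSpace ℝ (Fin n)) :
    EuclideanSpace ℝ (Fin n) × EuclideanSpace ℝ (Fin n) → ℝ :=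
  fun p => ‖p.2‖ ^ 2 / 2 - ⟪f p.1, p.2⟫_ℝ

/-- `e` is a hyperbolic saddle of `ẋ = F(x)` with stable and unstable dimension `n`, both on the
level of eigenvalues and on the level of the invariant manifolds. -/
structure IsHyperbolicSaddle {E : Type*} [NormedAddCommGroup E] [NormedSpace ℝ E]
    [FiniteDimensional ℝ E] (n : ℕ) (F : E → E) (e : E) : Prop where
  hyperbolic : IsHyperbolicEquilibrium F e
  pos : 0 < n
  stableIndex_eq : stableIndex F e = n
  unstableIndex_eq : unstableIndex F e = n
  stable_dim : StableManifoldHasDim F e n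
  unstable_dim : UnstableManifoldHasDim F e n

end EulerLagrange

end EscapePath

end

/-!
Write `A = f_u(e)` at an equilibrium `e`. As `A` is symmetric and invertible, the linearization
`(ξ, η) ↦ (-A ξ + η, A η)` of the Euler–Lagrange field at `(e, 0)` has an explicit real eigenbasis,
with eigenvalues `-μ` and `μ` for each eigenvalue `μ` of `A` (`exists_elField_eigenbasis`). This
gives the eigenvalue count. All the information about invariant manifolds comes from one theorem,
`stable_manifold`: at an equilibrium `e` of a smooth field `F` whose linearization is diagonalizable
with nonzero real eigenvalues, the stable manifold is smooth, its dimension is the number of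
negative eigenvalues, and its tangent space at `p` contains (and hence, by dimension, is) the space
of initial values of the decaying solutions of the equation linearized along the orbit of `p`.

The stable manifold theorem is proved for all points of the stable manifold at once, without using
smooth dependence of the flow on initial values. A plaque consists of the solutions that are
uniformly close to a given converging solution `x`, so it is the zero set of `z ↦ ż - F(z)` on a
Banach space of functions on the compactified half-line `[0, ∞]`, where this operator is smooth
(`contDiff_superposition`). Its derivative `ζ ↦ ζ̇ - F'(x(t)) ζ` is onto, with finite-dimensional
kernel: after a long time the coefficient is close to the constant `F'(e)`, for which the equation
decouples into scalar ones, and solvability extends backwards to time `0` since linear equations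
are solvable on compact intervals (`exists_bijective_linOp`). By the inverse function theorem the
small plaques are smooth graphs over open subsets of the space of initial values of the kernel
(`exists_plaque_eq_graph`).

For the transversality at `p = (u, 0)`, `u = h(-t)`: the function `H` is constant along solutions
and vanishes at `(a, 0)` and `(b, 0)`, so both manifolds lie in `H⁻¹(0)`, and `H'(p) ≠ 0` since
`f(u) ≠ 0` (an equilibrium on `h` would force `a = b`). The plane `v = 0` is invariant and carries
the flow of `-f`; hence `T_p Wᵘ(a, 0)` contains the `n`-dimensional plane `ℝⁿ × 0`, because `Wˢ(a)`
is open. The `n`-dimensional space `T_p Wˢ(b, 0)` meets this plane in decaying solutions of the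
equation for `-f` linearized along `h(-t)`, that is, in the tangent line of `Wᵘ(b)`. So the sum has
dimension at least `2n - 1 = dim H⁻¹(0)` (`transverseInside_elField`).
-/

namespace EscapePath

open scoped ENNReal


/-! ### Smoothness of superposition operators -/

section Superposition

universe u

variable {K : Type*} [TopologicalSpace K] [CompactSpace K]

/-- Pointwise application of a continuous field of operators to a continuous field of vectors, as
a bounded bilinear map. -/
noncomputable def pointwiseApply (K : Type*) [TopologicalSpace K] [CompactSpace K]
    (E F : Type*) [NormedAddCommGroup E] [NormedSpace ℝ E]
    [NormedAddCommGroup F] [NormedSpace ℝ F] :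
    C(K, E →L[ℝ] F) →L[ℝ] C(K, E) →L[ℝ] C(K, F) :=
  LinearMap.mkContinuous₂
    (LinearMap.mk₂ ℝ (fun (B : C(K, E →L[ℝ] F)) (z : C(K, E)) =>
        (⟨fun s => B s (z s), by fun_prop⟩ : C(K, F)))
      (fun B B' z => by ext s; simp) (fun c B z => by ext s; simp)
      (fun B z z' => by ext s; simp) (fun c B z => by ext s; simp)) 1
    (fun B z => by
      rw [ContinuousMap.norm_le _ (by positivity)]
      intro s
      simp only [LinearMap.mk₂_apply, ContinuousMap.coe_mk, one_mul]
      exact ((B s).le_opNorm _).trans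
        (mul_le_mul (B.norm_coe_le_norm s) (z.norm_coe_le_norm s) (norm_nonneg _) (by positivity)))

@[simp]
lemma pointwiseApply_apply {E F : Type*} [NormedAddCommGroup E] [NormedSpace ℝ E]
    [NormedAddCommGroup F] [NormedSpace ℝ F] (B : C(K, E →L[ℝ] F)) (z : C(K, E)) (s : K) :
    pointwiseApply K E F B z s = B s (z s) := rfl

lemma norm_pointwiseApply_le {E F : Type*} [NormedAddCommGroup E] [NormedSpace ℝ E]
    [NormedAddCommGroup F] [NormedSpace ℝ F] (B : C(K, E →L[ℝ] F)) :
    ‖pointwiseApply K E F B‖ ≤ ‖B‖ := by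
  refine ContinuousLinearMap.opNorm_le_bound _ (by positivity) fun z => ?_
  rw [ContinuousMap.norm_le _ (by positivity)]
  intro s
  exact ((B s).le_opNorm _).trans
    (mul_le_mul (B.norm_coe_le_norm s) (z.norm_coe_le_norm s) (norm_nonneg _) (by positivity))

/-- The superposition operator `z ↦ G ∘ z` on continuous functions is differentiable. -/
lemma hasFDerivAt_superposition {E F : Type*} [NormedAddCommGroup E] [NormedSpace ℝ E]
    [NormedAddCommGroup F] [NormedSpace ℝ F] (G : C(E, F)) (G' : C(E, E →L[ℝ] F))
    (hG : ∀ y, HasFDerivAt G (G' y) y) (z : C(K, E)) :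
    HasFDerivAt (fun w : C(K, E) => G.comp w) (pointwiseApply K E F (G'.comp z)) z := by
  rw [hasFDerivAt_iff_isLittleO_nhds_zero, Asymptotics.isLittleO_iff]
  intro c hc
  have hcont : Continuous fun w : C(K, E) => G'.comp w := ContinuousMap.continuous_postcomp G'
  obtain ⟨δ, hδ, hδ'⟩ := (Metric.continuous_iff (α := C(K, E)) (β := C(K, E →L[ℝ] F))).1 hcont z c hc
  filter_upwards [Metric.ball_mem_nhds (0 : C(K, E)) hδ] with w hw
  rw [ContinuousMap.norm_le _ (by positivity)]
  intro s
  have hwδ : ‖w‖ < δ := by simpa using hw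
  have hws : ‖w s‖ < δ := (w.norm_coe_le_norm s).trans_lt hwδ
  -- a point close to `z s` is the value at `s` of a function uniformly close to `z`
  have hbound : ∀ y ∈ Metric.ball (z s) δ, ‖G' y - G' (z s)‖ ≤ c := by
    intro y hy
    have h1 : dist (z + ContinuousMap.const K (y - z s)) z < δ := by
      rw [dist_eq_norm, add_sub_cancel_left, ContinuousMap.norm_lt_iff _ hδ]
      intro _
      simpa [dist_eq_norm] using hy
    have h2 := (ContinuousMap.dist_apply_le_dist s).trans_lt (hδ' _ h1)
    simpa [dist_eq_norm] using h2.le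
  have hmain := (convex_ball (z s) δ).norm_image_sub_le_of_norm_hasFDerivWithin_le'
    (fun y _ => (hG y).hasFDerivWithinAt) hbound (Metric.mem_ball_self hδ)
    (y := z s + w s) (by simpa using hws)
  simp only [add_sub_cancel_left] at hmain
  calc _ = ‖G (z s + w s) - G (z s) - (G' (z s)) (w s)‖ := by simp
    _ ≤ c * ‖w s‖ := hmain
    _ ≤ c * ‖w‖ := by gcongr; exact w.norm_coe_le_norm s

lemma contDiff_nat_superposition (n : ℕ) : ∀ {E F : Type u} [NormedAddCommGroup E]
    [NormedSpace ℝ E] [NormedAddCommGroup F] [NormedSpace ℝ F] (G : C(E, F)),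
    ContDiff ℝ n G → ContDiff ℝ n (fun w : C(K, E) => G.comp w) := by
  induction n with
  | zero =>
    intro E F _ _ _ _ G _
    exact contDiff_zero.2 (ContinuousMap.continuous_postcomp G)
  | succ n ih =>
    intro E F _ _ _ _ G hG
    have hG1 : ContDiff ℝ 1 G := hG.of_le (by norm_cast; omega)
    have hG' : ContDiff ℝ n (fderiv ℝ G) := hG.fderiv_right (by norm_cast)
    have hder := hasFDerivAt_superposition (K := K) G ⟨fderiv ℝ G, hG'.continuous⟩
      (fun y => (hG1.differentiable one_ne_zero y).hasFDerivAt)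
    rw [show ((n + 1 : ℕ) : WithTop ℕ∞) = n + 1 by norm_cast, contDiff_succ_iff_hasFDerivAt]
    exact ⟨fun z => pointwiseApply K E F ((⟨fderiv ℝ G, hG'.continuous⟩ : C(E, E →L[ℝ] F)).comp z),
      (ContinuousLinearMap.contDiff _).comp (ih ⟨fderiv ℝ G, hG'.continuous⟩ hG'), hder⟩

/-- The superposition operator of a smooth map is smooth on the Banach space of continuous
functions on a compact space. -/
lemma contDiff_superposition {E F : Type u} [NormedAddCommGroup E]
    [NormedSpace ℝ E] [NormedAddCommGroup F] [NormedSpace ℝ F] (G : C(E, F))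
    (hG : ContDiff ℝ ∞ G) : ContDiff ℝ ∞ (fun w : C(K, E) => G.comp w) :=
  contDiff_infty.2 fun n => contDiff_nat_superposition n G (contDiff_infty.1 hG n)

end Superposition

/-! ### Functions on the compactified half-line -/

section Trajectories

set_option linter.unusedSectionVars false

variable {E : Type*} [NormedAddCommGroup E] [NormedSpace ℝ E]

/-- The function of time `t ≥ 0` given by a continuous function on the compactified half-line
`[0, ∞]`; it is constant on the negative half-line. -/
noncomputable def traj (z : C(ℝ≥0∞, E)) (t : ℝ) : E := z (ENNReal.ofReal t)

lemma continuous_traj (z : C(ℝ≥0∞, E)) : Continuous (traj z) :=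
  z.continuous.comp ENNReal.continuous_ofReal

lemma tendsto_traj (z : C(ℝ≥0∞, E)) : Tendsto (traj z) atTop (𝓝 (z ⊤)) :=
  (z.continuous.tendsto ⊤).comp ENNReal.tendsto_ofReal_atTop

lemma norm_traj_le (z : C(ℝ≥0∞, E)) (t : ℝ) : ‖traj z t‖ ≤ ‖z‖ := z.norm_coe_le_norm _

@[simp] lemma traj_sub (z w : C(ℝ≥0∞, E)) (t : ℝ) : traj (z - w) t = traj z t - traj w t := rfl

@[simp] lemma traj_zero (t : ℝ) : traj (0 : C(ℝ≥0∞, E)) t = 0 := rfl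

lemma ext_traj {z w : C(ℝ≥0∞, E)} (h : ∀ t, 0 ≤ t → traj z t = traj w t) : z = w := by
  ext s
  induction s using ENNReal.recTopCoe with
  | top =>
    refine tendsto_nhds_unique (tendsto_traj z) ((tendsto_traj w).congr' ?_)
    filter_upwards [eventually_ge_atTop 0] with t ht using (h t ht).symm
  | coe r => simpa [traj] using h r r.2

/-- A continuous function on `[0, ∞)` with a limit at infinity extends to `[0, ∞]`. -/
lemma exists_traj_eq {y : ℝ → E} {l : E} (hy : ContinuousOn y (Ici 0))
    (hl : Tendsto y atTop (𝓝 l)) :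
    ∃ z : C(ℝ≥0∞, E), z ⊤ = l ∧ ∀ t, 0 ≤ t → traj z t = y t := by
  classical
  have hcont : Continuous fun s : ℝ≥0∞ => if s = ⊤ then l else y s.toReal := by
    rw [continuous_iff_continuousAt]
    intro s
    by_cases hs : s = ⊤
    · subst hs
      rw [ContinuousAt, if_pos rfl, tendsto_def]
      intro U hU
      obtain ⟨T, hT⟩ := mem_atTop_sets.1 (hl hU)
      have : Ioi (ENNReal.ofReal T) ∈ 𝓝 (⊤ : ℝ≥0∞) := Ioi_mem_nhds ENNReal.ofReal_lt_top
      filter_upwards [this] with r hr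
      by_cases hr' : r = ⊤
      · simpa [hr'] using mem_of_mem_nhds hU
      · simp only [mem_preimage, if_neg hr']
        exact hT _ ((ENNReal.ofReal_le_iff_le_toReal hr').1 (le_of_lt hr))
    · have h1 : ContinuousAt (fun s : ℝ≥0∞ => y s.toReal) s := by
        have := (hy s.toReal ENNReal.toReal_nonneg).tendsto
        refine this.comp (tendsto_nhdsWithin_iff.2 ⟨ENNReal.tendsto_toReal hs, ?_⟩)
        exact Eventually.of_forall fun _ => ENNReal.toReal_nonneg
      refine h1.congr ?_
      filter_upwards [isOpen_ne.mem_nhds hs] with r hr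
      rw [if_neg hr]
  refine ⟨⟨_, hcont⟩, by simp, fun t ht => ?_⟩
  simp [traj, ENNReal.toReal_ofReal ht]

lemma hasDerivWithinAt_iff_integral [CompleteSpace E] {y y' : ℝ → E} (hy' : Continuous y') :
    (∀ t, 0 ≤ t → HasDerivWithinAt y (y' t) (Ici 0) t) ↔
      ∀ t, 0 ≤ t → y t = y 0 + ∫ s in (0 : ℝ)..t, y' s := by
  constructor
  · intro h t ht
    rw [intervalIntegral.integral_eq_sub_of_hasDeriv_right_of_le ht
      (f := y) (f' := y') (fun s hs => ((h s hs.1).continuousWithinAt).mono Icc_subset_Ici_self)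
      (fun s hs => (h s hs.1.le).mono fun r hr => hs.1.le.trans (le_of_lt hr))
      (hy'.intervalIntegrable _ _)]
    simp
  · intro h t ht
    have := ((hy'.integral_hasStrictDerivAt 0 t).hasDerivAt.const_add (y 0)).hasDerivWithinAt
      (s := Ici 0)
    exact this.congr (fun s hs => h s hs) (h t ht)

variable (E) in
/-- The Banach space of `C¹` functions on `[0, ∞)` that converge at infinity together with their
derivatives, realized as the pairs (function, derivative) in `C([0, ∞], E) × C([0, ∞], E)`. -/
def diffSpace : Submodule ℝ (C(ℝ≥0∞, E) × C(ℝ≥0∞, E)) where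
  carrier := {p | ∀ t, 0 ≤ t → HasDerivWithinAt (traj p.1) (traj p.2 t) (Ici 0) t}
  add_mem' := fun hp hq t ht => (hp t ht).add (hq t ht)
  zero_mem' := fun t _ => hasDerivWithinAt_const t _ 0
  smul_mem' := fun c _ hp t ht => (hp t ht).const_smul c

lemma isClosed_diffSpace [CompleteSpace E] : IsClosed (diffSpace E : Set (C(ℝ≥0∞, E) × C(ℝ≥0∞, E))) := by
  have : (diffSpace E : Set (C(ℝ≥0∞, E) × C(ℝ≥0∞, E))) = ⋂ t : ℝ, ⋂ _ : 0 ≤ t,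
      {p | traj p.1 t = traj p.1 0 + ∫ s in (0 : ℝ)..t, traj p.2 s} := by
    ext p
    simp only [SetLike.mem_coe, mem_iInter, mem_ofPred_eq]
    exact hasDerivWithinAt_iff_integral (continuous_traj p.2)
  rw [this]
  refine isClosed_iInter fun t => isClosed_iInter fun ht => isClosed_eq ?_ ?_
  · exact (continuous_eval_const _).comp continuous_fst
  · refine ((continuous_eval_const _).comp continuous_fst).add ?_
    refine intervalIntegral.continuous_parametric_intervalIntegral_of_continuous' ?_ 0 t
    have : Continuous fun q : (C(ℝ≥0∞, E) × C(ℝ≥0∞, E)) × ℝ => q.1.2 (ENNReal.ofReal q.2) :=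
      ContinuousEval.continuous_eval.comp ((continuous_snd.comp continuous_fst).prodMk
        (ENNReal.continuous_ofReal.comp continuous_snd))
    exact this

instance [CompleteSpace E] : CompleteSpace (diffSpace E) :=
  isClosed_diffSpace.completeSpace_coe

variable (E) in
/-- Evaluation at time `t`. -/
noncomputable def evalAt (t : ℝ) : diffSpace E →L[ℝ] E :=
  ((ContinuousMap.evalCLM ℝ (ENNReal.ofReal t)).comp
    (ContinuousLinearMap.fst ℝ C(ℝ≥0∞, E) C(ℝ≥0∞, E))).comp (diffSpace E).subtypeL

/-- The operator `ζ ↦ ζ̇ - B ζ`. -/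
noncomputable def linOp (B : C(ℝ≥0∞, E →L[ℝ] E)) : diffSpace E →L[ℝ] C(ℝ≥0∞, E) :=
  (ContinuousLinearMap.snd ℝ C(ℝ≥0∞, E) C(ℝ≥0∞, E) -
    (pointwiseApply ℝ≥0∞ E E B).comp (ContinuousLinearMap.fst ℝ C(ℝ≥0∞, E) C(ℝ≥0∞, E))).comp
      (diffSpace E).subtypeL

lemma linOp_apply (B : C(ℝ≥0∞, E →L[ℝ] E)) (p : diffSpace E) :
    linOp B p = p.1.2 - pointwiseApply ℝ≥0∞ E E B p.1.1 := rfl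

lemma norm_linOp_sub_le (B B' : C(ℝ≥0∞, E →L[ℝ] E)) : ‖linOp B - linOp B'‖ ≤ ‖B - B'‖ := by
  refine ContinuousLinearMap.opNorm_le_bound _ (by positivity) fun p => ?_
  have h : (linOp B - linOp B') p = - pointwiseApply ℝ≥0∞ E E (B - B') p.1.1 := by
    simp only [sub_apply, linOp_apply, map_sub]
    abel
  rw [h, norm_neg]
  refine (ContinuousLinearMap.le_opNorm _ _).trans ?_
  have h1 : ‖p.1.1‖ ≤ ‖p‖ := norm_fst_le p.1
  exact mul_le_mul (norm_pointwiseApply_le _) h1 (by positivity) (by positivity)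

lemma traj_snd_of_linOp_eq {B : C(ℝ≥0∞, E →L[ℝ] E)} {p : diffSpace E} {g : C(ℝ≥0∞, E)}
    (h : linOp B p = g) (t : ℝ) : traj p.1.2 t = traj B t (traj p.1.1 t) + traj g t := by
  rw [linOp_apply] at h
  rw [← h]
  simp [traj]

lemma hasDerivWithinAt_of_linOp_eq {B : C(ℝ≥0∞, E →L[ℝ] E)} {p : diffSpace E} {g : C(ℝ≥0∞, E)}
    (h : linOp B p = g) {t : ℝ} (ht : 0 ≤ t) :
    HasDerivWithinAt (traj p.1.1) (traj B t (traj p.1.1 t) + traj g t) (Ici 0) t := by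
  rw [← traj_snd_of_linOp_eq h]
  exact p.2 t ht

/-- A convergent solution of `ζ̇ = B ζ + g` is an element of the Banach space on which `linOp B`
acts. -/
lemma exists_linOp_eq {B : C(ℝ≥0∞, E →L[ℝ] E)} {g : C(ℝ≥0∞, E)} {y : ℝ → E} {l : E}
    (hy : ∀ t, 0 ≤ t → HasDerivWithinAt y (traj B t (y t) + traj g t) (Ici 0) t)
    (hl : Tendsto y atTop (𝓝 l)) :
    ∃ p : diffSpace E, linOp B p = g ∧ ∀ t, 0 ≤ t → traj p.1.1 t = y t := by
  obtain ⟨z, -, hz⟩ := exists_traj_eq (fun t ht => (hy t ht).continuousWithinAt) hl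
  refine ⟨⟨(z, pointwiseApply ℝ≥0∞ E E B z + g), fun t ht => ?_⟩, ?_, hz⟩
  · have h1 : traj (pointwiseApply ℝ≥0∞ E E B z + g) t = traj B t (y t) + traj g t := by
      rw [← hz t ht]; rfl
    rw [h1]
    exact (hy t ht).congr (fun s hs => hz s hs) (hz t ht)
  · rw [linOp_apply]
    simp

/-- A solution of a linear equation that vanishes at time `T` vanishes after `T`. -/
lemma linear_ode_unique {B : ℝ → E →L[ℝ] E} (hB : Continuous B) {T : ℝ} {y : ℝ → E}
    (hy : ∀ t, T ≤ t → HasDerivWithinAt y (B t (y t)) (Ici T) t) (h0 : y T = 0) :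
    ∀ t, T ≤ t → y t = 0 := by
  intro t ht
  obtain ⟨C, hC⟩ := (isCompact_Icc (a := T) (b := t)).exists_bound_of_continuousOn hB.continuousOn
  refine eq_zero_of_abs_deriv_le_mul_abs_self_of_eq_zero_right (f := y)
    (f' := fun s => B s (y s)) (K := C) (a := T) (b := t)
    (fun s hs => ((hy s hs.1).continuousWithinAt).mono Icc_subset_Ici_self)
    (fun s hs => (hy s hs.1).mono (Ici_subset_Ici.2 hs.1)) h0 ?_ t ⟨ht, le_rfl⟩
  intro s hs
  exact ((B s).le_opNorm _).trans (by gcongr; exact hC s ⟨hs.1, hs.2.le⟩)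

/-- A solution of a linear equation on `[0, ∞)` that vanishes at time `T` vanishes before `T`. -/
lemma linear_ode_unique_left {B : ℝ → E →L[ℝ] E} (hB : Continuous B) {T : ℝ} {y : ℝ → E}
    (hy : ∀ t, 0 ≤ t → HasDerivWithinAt y (B t (y t)) (Ici 0) t) (h0 : y T = 0) :
    ∀ t, 0 ≤ t → t ≤ T → y t = 0 := by
  intro t ht htT
  obtain ⟨C, hC⟩ := (isCompact_Icc (a := 0) (b := T)).exists_bound_of_continuousOn hB.continuousOn
  have key := eq_zero_of_abs_deriv_le_mul_abs_self_of_eq_zero_right (f := fun s => y (T - s))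
    (f' := fun s => - B (T - s) (y (T - s))) (K := C) (a := 0) (b := T) ?_ ?_ (by simpa using h0) ?_
    (T - t) ⟨by linarith, by linarith⟩
  · simpa using key
  · intro s hs
    have h1 := (hy (T - s) (by linarith [hs.2])).continuousWithinAt
    exact h1.comp (t := Ici 0) (continuous_const.sub continuous_id).continuousWithinAt
      (fun r hr => by simpa using hr.2)
  · intro s hs
    have h1 : HasDerivAt y (B (T - s) (y (T - s))) (T - s) :=
      (hy (T - s) (by linarith [hs.2])).hasDerivAt (Ici_mem_nhds (by linarith [hs.2]))
    have h2 := h1.scomp s ((hasDerivAt_id s).const_sub T)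
    simpa [Function.comp_def] using h2.hasDerivWithinAt
  · intro s hs
    rw [norm_neg]
    exact ((B _).le_opNorm _).trans
      (by gcongr; exact hC _ ⟨by linarith [hs.2], by linarith [hs.1]⟩)

end Trajectories

/-! ### Scalar linear equations on the half-line -/

section ScalarEquation

/-- Solutions of `ẏ = -m y + g` with `m > 0` converge if `g` does. -/
lemma tendsto_of_stable_scalar {m : ℝ} (hm : 0 < m) {g y : ℝ → ℝ} {l : ℝ}
    (hg : Tendsto g atTop (𝓝 l)) (hy : ∀ t, 0 ≤ t → HasDerivWithinAt y (-m * y t + g t) (Ici 0) t) :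
    Tendsto y atTop (𝓝 (l / m)) := by
  have hexp : ∀ t : ℝ, HasDerivAt (fun t => Real.exp (m * t)) (m * Real.exp (m * t)) t := by
    intro t
    simpa [mul_comm] using ((hasDerivAt_id t).const_mul m).exp
  set φ : ℝ → ℝ := fun t => Real.exp (m * t) * (y t - l / m) with hφ
  have hφ' : ∀ t, 0 ≤ t →
      HasDerivWithinAt φ (Real.exp (m * t) * (g t - l)) (Ici 0) t := by
    intro t ht
    have := (hexp t).hasDerivWithinAt.mul ((hy t ht).sub_const (l / m))
    refine this.congr_deriv ?_
    field_simp
    ring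
  rw [Metric.tendsto_nhds]
  intro ε hε
  obtain ⟨T, hT0, hT⟩ : ∃ T : ℝ, 0 ≤ T ∧ ∀ t, T ≤ t → |g t - l| ≤ ε * m / 2 := by
    have h1 := (Metric.tendsto_nhds.1 hg) (ε * m / 2) (by positivity)
    obtain ⟨T, hT⟩ := eventually_atTop.1 (h1.and (eventually_ge_atTop 0))
    exact ⟨T, (hT T le_rfl).2, fun t ht => (hT t ht).1.le⟩
  have hbound : ∀ t, T ≤ t →
      ‖φ t‖ ≤ ‖φ T‖ + ε / 2 * (Real.exp (m * t) - Real.exp (m * T)) := by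
    intro t ht
    refine image_norm_le_of_norm_deriv_right_le_deriv_boundary
      (f' := fun t => Real.exp (m * t) * (g t - l))
      (B := fun t => ‖φ T‖ + ε / 2 * (Real.exp (m * t) - Real.exp (m * T)))
      (B' := fun t => ε / 2 * (m * Real.exp (m * t)))
      (fun s hs => ((hφ' s (hT0.trans hs.1)).continuousWithinAt).mono
        fun r hr => hT0.trans hr.1)
      (fun s hs => (hφ' s (hT0.trans hs.1)).mono (Ici_subset_Ici.2 (hT0.trans hs.1)))
      (by simp) (fun s => (((hexp s).sub_const _).const_mul _).const_add _) ?_ ⟨ht, le_rfl⟩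
    intro s hs
    rw [norm_mul, Real.norm_eq_abs, Real.norm_eq_abs, Real.abs_exp]
    nlinarith [hT s hs.1, Real.exp_pos (m * s)]
  have hdecay : Tendsto (fun t => ‖φ T‖ * Real.exp (-(m * t))) atTop (𝓝 0) := by
    have h1 : Tendsto (fun t => m * t) atTop atTop := tendsto_id.const_mul_atTop hm
    simpa using (Real.tendsto_exp_neg_atTop_nhds_zero.comp h1).const_mul ‖φ T‖
  filter_upwards [eventually_ge_atTop T, (Metric.tendsto_nhds.1 hdecay) (ε / 2) (by positivity)]
    with t ht hdt
  have h1 := hbound t ht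
  rw [hφ] at h1
  simp only [norm_mul, Real.norm_eq_abs, Real.abs_exp] at h1
  rw [Real.dist_eq, sub_zero, abs_of_nonneg (by positivity), Real.exp_neg, ← div_eq_mul_inv,
    div_lt_iff₀ (Real.exp_pos _)] at hdt
  rw [Real.dist_eq]
  have h2 : Real.exp (m * t) * |y t - l / m| < Real.exp (m * t) * ε := by
    have : ‖φ T‖ = Real.exp (m * T) * |y T - l / m| := by simp [hφ, Real.abs_exp]
    nlinarith [Real.exp_pos (m * T)]
  exact lt_of_mul_lt_mul_left h2 (Real.exp_pos _).le

lemma exists_stable_scalar {μ : ℝ} (hμ : μ < 0) {g : ℝ → ℝ} {l : ℝ} (hgc : Continuous g)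
    (hg : Tendsto g atTop (𝓝 l)) (ξ : ℝ) :
    ∃ y : ℝ → ℝ, (∀ t, HasDerivAt y (μ * y t + g t) t) ∧ y 0 = ξ ∧
      ∃ l', Tendsto y atTop (𝓝 l') := by
  set y : ℝ → ℝ := fun t =>
    Real.exp (μ * t) * (ξ + ∫ s in (0 : ℝ)..t, Real.exp (-(μ * s)) * g s) with hy
  have hder : ∀ t, HasDerivAt y (μ * y t + g t) t := by
    intro t
    have h1 : HasDerivAt (fun t => Real.exp (μ * t)) (Real.exp (μ * t) * (μ * 1)) t :=
      ((hasDerivAt_id t).const_mul μ).exp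
    have hc : Continuous fun s => Real.exp (-(μ * s)) * g s := by fun_prop
    refine (h1.mul ((hc.integral_hasStrictDerivAt 0 t).hasDerivAt.const_add ξ)).congr_deriv ?_
    rw [← mul_assoc (Real.exp (μ * t)) (Real.exp (-(μ * t))), ← Real.exp_add]
    simp only [hy, add_neg_cancel, Real.exp_zero]
    ring
  refine ⟨y, hder, by simp [hy], _, tendsto_of_stable_scalar (m := -μ) (by linarith) hg ?_⟩
  intro t _
  simpa using (hder t).hasDerivWithinAt

lemma exists_unstable_scalar {μ : ℝ} (hμ : 0 < μ) {g : ℝ → ℝ} {l : ℝ} (hgc : Continuous g)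
    (hg : Tendsto g atTop (𝓝 l)) {C : ℝ} (hC : ∀ t, |g t| ≤ C) :
    ∃ y : ℝ → ℝ, (∀ t, HasDerivAt y (μ * y t + g t) t) ∧ ∃ l', Tendsto y atTop (𝓝 l') := by
  have hc : Continuous fun s => Real.exp (-(μ * s)) * g s := by fun_prop
  have hint : MeasureTheory.IntegrableOn (fun s => Real.exp (-(μ * s)) * g s) (Ioi 0) := by
    have h1 := (integrableOn_exp_mul_Ioi (a := -μ) (by linarith) 0).mul_const C
    refine MeasureTheory.Integrable.mono' h1 hc.aestronglyMeasurable ?_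
    refine Eventually.of_forall fun s => ?_
    rw [norm_mul, Real.norm_eq_abs, Real.norm_eq_abs, Real.abs_exp, neg_mul]
    gcongr
    exact hC s
  -- the initial value is fixed by the requirement that the solution stays bounded
  set J : ℝ := ∫ s in Ioi (0 : ℝ), Real.exp (-(μ * s)) * g s with hJ
  set N : ℝ → ℝ := fun t => (∫ s in (0 : ℝ)..t, Real.exp (-(μ * s)) * g s) - J with hN
  have hN' : ∀ t, HasDerivAt N (Real.exp (-(μ * t)) * g t) t := fun t =>
    (hc.integral_hasStrictDerivAt 0 t).hasDerivAt.sub_const J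
  have hE' : ∀ t, HasDerivAt (fun t => Real.exp (-(μ * t))) (Real.exp (-(μ * t)) * (-(μ * 1))) t :=
    fun t => ((hasDerivAt_id t).const_mul μ).neg.exp
  refine ⟨fun t => Real.exp (μ * t) * N t, fun t => ?_, l / (-μ), ?_⟩
  · have h1 : HasDerivAt (fun t => Real.exp (μ * t)) (Real.exp (μ * t) * (μ * 1)) t :=
      ((hasDerivAt_id t).const_mul μ).exp
    refine (h1.mul (hN' t)).congr_deriv ?_
    rw [← mul_assoc (Real.exp (μ * t)) (Real.exp (-(μ * t))), ← Real.exp_add]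
    simp only [add_neg_cancel, Real.exp_zero]
    ring
  · have hNlim : Tendsto N atTop (𝓝 0) := by
      have := (MeasureTheory.intervalIntegral_tendsto_integral_Ioi 0 hint tendsto_id).sub_const J
      simpa [hJ] using this
    have hElim : Tendsto (fun t => Real.exp (-(μ * t))) atTop (𝓝 0) :=
      Real.tendsto_exp_neg_atTop_nhds_zero.comp (tendsto_id.const_mul_atTop hμ)
    have := HasDerivAt.lhopital_zero_atTop (l := 𝓝 (l / (-μ)))
      (Eventually.of_forall hN') (Eventually.of_forall hE')
      (Eventually.of_forall fun t => by
        have := Real.exp_pos (-(μ * t)); simp; exact hμ.ne') hNlim hElim ?_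
    · refine this.congr fun t => ?_
      rw [Real.exp_neg]
      field_simp
    · refine (hg.div_const (-μ)).congr fun t => ?_
      have := (Real.exp_pos (-(μ * t))).ne'
      field_simp

/-- A bounded solution of `ẏ = μ y` vanishes if `μ > 0`, or if `μ < 0` and `y(0) = 0`. -/
lemma eq_zero_of_scalar {μ : ℝ} {y : ℝ → ℝ}
    (hy : ∀ t, 0 ≤ t → HasDerivWithinAt y (μ * y t) (Ici 0) t)
    {C : ℝ} (hC : ∀ t, |y t| ≤ C) (h : 0 < μ ∨ y 0 = 0) (t : ℝ) (ht : 0 ≤ t) : y t = 0 := by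
  have hconst : ∀ t, 0 ≤ t → Real.exp (-(μ * t)) * y t = y 0 := by
    intro t ht
    have h1 : ∀ s, 0 ≤ s →
        HasDerivWithinAt (fun s => Real.exp (-(μ * s)) * y s) 0 (Ici 0) s := by
      intro s hs
      have h2 : HasDerivAt (fun t => Real.exp (-(μ * t))) (Real.exp (-(μ * s)) * (-(μ * 1))) s :=
        ((hasDerivAt_id s).const_mul μ).neg.exp
      refine (h2.hasDerivWithinAt.mul (hy s hs)).congr_deriv ?_
      ring
    have := constant_of_has_deriv_right_zero (a := 0) (b := t)
      (fun s hs => ((h1 s hs.1).continuousWithinAt).mono Icc_subset_Ici_self)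
      (fun s hs => (h1 s hs.1).mono (Ici_subset_Ici.2 hs.1)) t ⟨ht, le_rfl⟩
    simpa using this
  have h0 : y 0 = 0 := by
    rcases h with hμ | h0
    · have hlim : Tendsto (fun t => Real.exp (-(μ * t)) * y t) atTop (𝓝 0) := by
        have hE : Tendsto (fun t => C * Real.exp (-(μ * t))) atTop (𝓝 0) := by
          simpa using (Real.tendsto_exp_neg_atTop_nhds_zero.comp
            (tendsto_id.const_mul_atTop hμ)).const_mul C
        refine squeeze_zero_norm (fun t => ?_) hE
        rw [norm_mul, Real.norm_eq_abs, Real.norm_eq_abs, Real.abs_exp, mul_comm]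
        gcongr
        exact hC t
      refine tendsto_nhds_unique (tendsto_const_nhds (x := y 0) (f := atTop)) (hlim.congr' ?_)
      filter_upwards [eventually_ge_atTop 0] with t ht using hconst t ht
    · exact h0
  have := hconst t ht
  rw [h0] at this
  simpa using this

end ScalarEquation

/-! ### Hyperbolic linear equations with nearly constant coefficients -/

section Hyperbolic

set_option linter.unusedSectionVars false

variable {E : Type*} [NormedAddCommGroup E] [NormedSpace ℝ E] [FiniteDimensional ℝ E]
  {ι : Type*} [Fintype ι]

/-- The coordinates, in an eigenbasis `v` with eigenvalues `μ`, in the stable directions. -/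
noncomputable def stableCoord (v : Module.Basis ι ℝ E) (μ : ι → ℝ) :
    E →L[ℝ] ({i // μ i < 0} → ℝ) :=
  LinearMap.toContinuousLinearMap
    ((LinearMap.funLeft ℝ ℝ (Subtype.val : {i // μ i < 0} → ι)).comp
      (v.equivFun : E →ₗ[ℝ] ι → ℝ))

lemma repr_apply_of_eigen {v : Module.Basis ι ℝ E} {μ : ι → ℝ} {A : E →L[ℝ] E}
    (hA : ∀ i, A (v i) = μ i • v i) (x : E) (i : ι) : v.repr (A x) i = μ i * v.repr x i := by
  classical
  conv_lhs => rw [← v.sum_repr x]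
  simp only [map_sum, map_smul, hA, Finsupp.coe_finsetSum, Finset.sum_apply, Finsupp.smul_apply,
    Module.Basis.repr_self, smul_eq_mul]
  rw [Finset.sum_eq_single i]
  · simp [mul_comm]
  · intro j _ hj
    simp [hj]
  · simp

/-- For a constant hyperbolic diagonal coefficient, `ζ̇ = A ζ + g` has a unique convergent solution
with prescribed stable part of the initial value. -/
lemma bijective_linOp_const {v : Module.Basis ι ℝ E} {μ : ι → ℝ} (hμ : ∀ i, μ i ≠ 0)
    {A : E →L[ℝ] E} (hA : ∀ i, A (v i) = μ i • v i) :
    Function.Bijective ((linOp (ContinuousMap.const ℝ≥0∞ A)).prod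
      ((stableCoord v μ).comp (evalAt E 0))) := by
  classical
  have coord : ∀ i, ∃ c : E →L[ℝ] ℝ, ∀ x, c x = v.repr x i := fun i =>
    ⟨LinearMap.toContinuousLinearMap (v.coord i), fun x => rfl⟩
  constructor
  · rw [injective_iff_map_eq_zero]
    intro p hp
    have hp1 : linOp (ContinuousMap.const ℝ≥0∞ A) p = 0 := congrArg Prod.fst hp
    have hp2 : stableCoord v μ (traj p.1.1 0) = 0 := congrArg Prod.snd hp
    have hz : ∀ t, 0 ≤ t → traj p.1.1 t = 0 := by
      intro t ht
      refine v.ext_elem fun i => ?_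
      obtain ⟨c, hc⟩ := coord i
      rw [map_zero, Finsupp.zero_apply]
      refine eq_zero_of_scalar (μ := μ i) (y := fun t => v.repr (traj p.1.1 t) i) (C := ‖c‖ * ‖p.1.1‖)
        ?_ ?_ ?_ t ht
      · intro s hs
        have h1 := c.hasFDerivAt.comp_hasDerivWithinAt s (hasDerivWithinAt_of_linOp_eq hp1 hs)
        have h2 : c (traj (ContinuousMap.const ℝ≥0∞ A) s (traj p.1.1 s) + traj 0 s)
            = μ i * v.repr (traj p.1.1 s) i := by
          rw [hc, traj_zero, add_zero, ← repr_apply_of_eigen hA]; rfl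
        rw [h2] at h1
        exact h1.congr (fun r _ => (hc _).symm) (hc _).symm
      · intro s
        rw [← hc]
        exact (c.le_opNorm _).trans (by gcongr; exact norm_traj_le _ _)
      · rcases (hμ i).lt_or_gt with h | h
        · exact Or.inr (congrFun hp2 ⟨i, h⟩)
        · exact Or.inl h
    have h1 : p.1.1 = 0 := ext_traj fun t ht => by simpa using hz t ht
    have h2 : p.1.2 = 0 := by
      rw [linOp_apply, h1, map_zero, sub_zero] at hp1
      exact hp1
    exact Subtype.ext (Prod.ext h1 h2)
  · rintro ⟨g, ξ⟩
    have hscalar : ∀ i, ∃ y : ℝ → ℝ, (∀ t, HasDerivAt y (μ i * y t + v.repr (traj g t) i) t) ∧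
        (∀ h : μ i < 0, y 0 = ξ ⟨i, h⟩) ∧ ∃ l', Tendsto y atTop (𝓝 l') := by
      intro i
      obtain ⟨c, hc⟩ := coord i
      have hcont : Continuous fun t => v.repr (traj g t) i := by
        simp only [← hc]
        exact c.continuous.comp (continuous_traj g)
      have hlim : Tendsto (fun t => v.repr (traj g t) i) atTop (𝓝 (c (g ⊤))) := by
        simp only [← hc]
        exact (c.continuous.tendsto _).comp (tendsto_traj g)
      rcases (hμ i).lt_or_gt with h | h
      · obtain ⟨y, h1, h2, h3⟩ := exists_stable_scalar h hcont hlim (ξ ⟨i, h⟩)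
        exact ⟨y, h1, fun _ => h2, h3⟩
      · obtain ⟨y, h1, h3⟩ := exists_unstable_scalar h hcont hlim (C := ‖c‖ * ‖g‖) (by
          intro t
          rw [← hc]
          exact (c.le_opNorm _).trans (by gcongr; exact norm_traj_le _ _))
        exact ⟨y, h1, fun h' => absurd h' h.not_gt, h3⟩
    choose y hy hy0 l hl using hscalar
    obtain ⟨p, hp, hpy⟩ := exists_linOp_eq (B := ContinuousMap.const ℝ≥0∞ A) (g := g)
      (y := fun t => ∑ i, y i t • v i) (l := ∑ i, l i • v i) (by
        intro t _
        have h1 : HasDerivAt (fun t => ∑ i, y i t • v i)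
            (∑ i, (μ i * y i t + v.repr (traj g t) i) • v i) t :=
          HasDerivAt.fun_sum fun i _ => (hy i t).smul_const (v i)
        refine h1.hasDerivWithinAt.congr_deriv ?_
        conv_rhs => rw [← v.sum_repr (traj g t)]
        simp only [add_smul, Finset.sum_add_distrib]
        congr 1
        simp only [traj, ContinuousMap.const_apply, map_sum, map_smul, hA, smul_smul]
        refine Finset.sum_congr rfl fun i _ => by rw [mul_comm])
      (tendsto_finsetSum _ fun i _ => (hl i).smul_const (v i))
    refine ⟨p, Prod.ext hp ?_⟩
    ext i
    change v.repr (traj p.1.1 0) i = ξ i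
    rw [hpy 0 le_rfl]
    rw [v.repr_sum_self]
    exact hy0 i i.2

lemma bijective_linOp_of_norm_sub_lt {F : Type*} [NormedAddCommGroup F] [NormedSpace ℝ F]
    [CompleteSpace F] {B₀ : C(ℝ≥0∞, E →L[ℝ] E)} {c : diffSpace E →L[ℝ] F}
    (h : Function.Bijective ((linOp B₀).prod c)) :
    ∃ δ > 0, ∀ B, ‖B - B₀‖ < δ → Function.Bijective ((linOp B).prod c) := by
  set e := ContinuousLinearEquiv.ofBijective ((linOp B₀).prod c)
    (LinearMap.ker_eq_bot.2 h.1) (LinearMap.range_eq_top.2 h.2) with he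
  have h1 := ContinuousLinearEquiv.nhds e
  obtain ⟨δ, hδ, hball⟩ := Metric.mem_nhds_iff.1 h1
  refine ⟨δ, hδ, fun B hB => ?_⟩
  obtain ⟨e', he'⟩ := hball (a := (linOp B).prod c) (by
    have h2 : (linOp B).prod c - (e : diffSpace E →L[ℝ] _) = (linOp B - linOp B₀).prod 0 := by
      ext p <;> simp [he]
    rw [Metric.mem_ball, dist_eq_norm, h2]
    refine lt_of_le_of_lt ?_ hB
    refine ContinuousLinearMap.opNorm_le_bound _ (by positivity) fun p => ?_
    have h3 : ‖(linOp B - linOp B₀) p‖ ≤ ‖B - B₀‖ * ‖p‖ :=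
      ((linOp B - linOp B₀).le_opNorm p).trans (by gcongr; exact norm_linOp_sub_le _ _)
    simpa [Prod.norm_def] using h3)
  have : ((linOp B).prod c : diffSpace E → _) = e' := by rw [← he']; rfl
  rw [this]
  exact e'.bijective

end Hyperbolic

/-! ### Existence for linear equations and time shifts -/

section LinearExistence

set_option linter.unusedSectionVars false

variable {E : Type*} [NormedAddCommGroup E] [NormedSpace ℝ E]

lemma norm_le_of_traj {z : C(ℝ≥0∞, E)} {C : ℝ} (h : ∀ t, 0 ≤ t → ‖traj z t‖ ≤ C) : ‖z‖ ≤ C := by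
  rw [ContinuousMap.norm_le _ ((norm_nonneg _).trans (h 0 le_rfl))]
  intro s
  induction s using ENNReal.recTopCoe with
  | top =>
    refine le_of_tendsto (tendsto_traj z).norm ?_
    filter_upwards [eventually_ge_atTop 0] with t ht using h t ht
  | coe r => simpa [traj] using h r r.2

/-- Linear equations have solutions on every compact interval. In the rescaled time `s = λ t` and
for `y(t) = exp(λ t) η(λ t)` the equation becomes a small perturbation of `η' = -η`. -/
lemma exists_linear_ode [FiniteDimensional ℝ E] {B : ℝ → E →L[ℝ] E} (hB : Continuous B)
    {g : ℝ → E} (hg : Continuous g) (T : ℝ) (ξ : E) :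
    ∃ y : ℝ → E, y 0 = ξ ∧
      ∀ t ∈ Icc 0 T, HasDerivWithinAt y (B t (y t) + g t) (Icc 0 T) t := by
  set v := Module.finBasis ℝ E
  set μ : Fin (Module.finrank ℝ E) → ℝ := fun _ => -1
  obtain ⟨δ, hδ, hpert⟩ := bijective_linOp_of_norm_sub_lt
    (bijective_linOp_const (v := v) (μ := μ) (fun _ => by simp [μ])
      (A := -ContinuousLinearMap.id ℝ E) (fun i => by simp [μ]))
  obtain ⟨M, hM⟩ : ∃ M, ∀ s : ℝ, 0 ≤ s → ‖B (min s T)‖ ≤ M := by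
    obtain ⟨M, hM⟩ := (isCompact_Icc (a := min 0 T) (b := T)).exists_bound_of_continuousOn
      hB.continuousOn
    exact ⟨M, fun s hs => hM _ ⟨min_le_min_right T hs, min_le_right _ _⟩⟩
  obtain ⟨k, hk⟩ := exists_nat_gt (max 1 (M / δ))
  have hk0 : (0 : ℝ) < k := by have := le_max_left 1 (M / δ); linarith
  have hkM : M / k < δ := by
    rw [div_lt_iff₀ hk0]
    have := (le_max_right 1 (M / δ)).trans_lt hk
    rwa [div_lt_iff₀ hδ, mul_comm] at this
  have hev : ∀ᶠ s : ℝ in atTop, min (s / k) T = T := by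
    filter_upwards [eventually_ge_atTop (T * k)] with s hs
    rw [min_eq_right]
    rwa [le_div_iff₀ hk0]
  obtain ⟨B₁, -, hB₁⟩ := exists_traj_eq
    (y := fun s => -ContinuousLinearMap.id ℝ E + (k : ℝ)⁻¹ • B (min (s / k) T))
    (l := -ContinuousLinearMap.id ℝ E + (k : ℝ)⁻¹ • B T)
    (Continuous.continuousOn (by fun_prop))
    (tendsto_const_nhds.congr' (by filter_upwards [hev] with s hs; rw [hs]))
  obtain ⟨g₁, -, hg₁⟩ := exists_traj_eq
    (y := fun s => ((k : ℝ)⁻¹ * Real.exp (-s)) • g (min (s / k) T)) (l := 0)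
    (Continuous.continuousOn (by fun_prop))
    (by
      have h1 : Tendsto (fun s => ((k : ℝ)⁻¹ * Real.exp (-s)) • g T) atTop (𝓝 0) := by
        simpa using ((Real.tendsto_exp_neg_atTop_nhds_zero.const_mul (k : ℝ)⁻¹).smul_const (g T))
      exact h1.congr' (by filter_upwards [hev] with s hs; rw [hs]))
  have hclose : ‖B₁ - ContinuousMap.const ℝ≥0∞ (-ContinuousLinearMap.id ℝ E)‖ < δ := by
    refine lt_of_le_of_lt (norm_le_of_traj (C := M / k) fun t ht => ?_) hkM
    rw [traj_sub, hB₁ t ht]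
    simp only [traj, ContinuousMap.const_apply, add_sub_cancel_left]
    rw [norm_smul, norm_inv, Real.norm_of_nonneg hk0.le, div_eq_inv_mul M]
    gcongr
    exact hM _ (by positivity)
  obtain ⟨p, hp⟩ := (hpert B₁ hclose).2 (g₁, stableCoord v μ ξ)
  have hp1 : linOp B₁ p = g₁ := congrArg Prod.fst hp
  have hp2 : stableCoord v μ (traj p.1.1 0) = stableCoord v μ ξ := congrArg Prod.snd hp
  refine ⟨fun t => Real.exp (k * t) • traj p.1.1 (k * t), ?_, fun t ht => ?_⟩
  · simp only [mul_zero, Real.exp_zero, one_smul]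
    exact v.ext_elem fun i => congrFun hp2 ⟨i, by simp [μ]⟩
  · have hkt : 0 ≤ k * t := mul_nonneg hk0.le ht.1
    have hmin : min (k * t / k) T = t := by
      rw [mul_div_cancel_left₀ _ hk0.ne', min_eq_left ht.2]
    have h1 := hasDerivWithinAt_of_linOp_eq hp1 hkt
    rw [hB₁ _ hkt, hg₁ _ hkt, hmin] at h1
    have h2 : HasDerivWithinAt (fun t : ℝ => k * t) (k * 1) (Icc 0 T) t :=
      ((hasDerivAt_id t).const_mul (k : ℝ)).hasDerivWithinAt
    have h3 := h1.scomp t h2 (fun s hs => mul_nonneg hk0.le hs.1)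
    have h4 : HasDerivWithinAt (fun t : ℝ => Real.exp (k * t))
      (Real.exp (k * t) * (k * 1)) (Icc 0 T) t := h2.exp
    refine (h4.smul h3).congr_deriv ?_
    simp only [Function.comp_apply, mul_one, add_apply, neg_apply,
      ContinuousLinearMap.id_apply, smul_apply, map_smul, smul_add, smul_smul,
      Real.exp_neg, smul_neg]
    have e1 : Real.exp (k * t) * k * (k : ℝ)⁻¹ = Real.exp (k * t) := by field_simp
    have e2 : Real.exp (k * t) * (Real.exp (k * t))⁻¹ = 1 := mul_inv_cancel₀ (Real.exp_pos _).ne'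
    simp only [← mul_assoc]
    rw [e1, e2, one_smul]
    abel

/-- Linear equations have solutions on `[0, T]` with prescribed value at time `T`. -/
lemma exists_linear_ode_backward [FiniteDimensional ℝ E] {B : ℝ → E →L[ℝ] E} (hB : Continuous B)
    {g : ℝ → E} (hg : Continuous g) (T : ℝ) (ξ : E) :
    ∃ y : ℝ → E, y T = ξ ∧
      ∀ t ∈ Icc 0 T, HasDerivWithinAt y (B t (y t) + g t) (Icc 0 T) t := by
  obtain ⟨y, hy0, hy⟩ := exists_linear_ode (B := fun s => -B (T - s)) (by fun_prop)
    (g := fun s => -g (T - s)) (by fun_prop) T ξ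
  refine ⟨fun t => y (T - t), by simpa using hy0, fun t ht => ?_⟩
  have h1 := hy (T - t) ⟨by linarith [ht.2], by linarith [ht.1]⟩
  have h2 : HasDerivWithinAt (fun t => T - t) (-1) (Icc 0 T) t :=
    ((hasDerivAt_id t).const_sub T).hasDerivWithinAt
  have h3 := h1.scomp t h2 (fun s hs => ⟨by linarith [hs.2], by linarith [hs.1]⟩)
  simp only [sub_sub_cancel, neg_apply] at h3
  refine h3.congr_deriv ?_
  simp [add_comm]

/-- The time shift `z ↦ z(· + T)`. -/
noncomputable def shift (T : ℝ) (z : C(ℝ≥0∞, E)) : C(ℝ≥0∞, E) :=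
  z.comp ⟨fun s => s + ENNReal.ofReal T, by fun_prop⟩

lemma traj_shift {T : ℝ} (hT : 0 ≤ T) (z : C(ℝ≥0∞, E)) {t : ℝ} (ht : 0 ≤ t) :
    traj (shift T z) t = traj z (t + T) := by
  simp [traj, shift, ENNReal.ofReal_add ht hT]

lemma exists_norm_shift_sub_lt (z : C(ℝ≥0∞, E)) {δ : ℝ} (hδ : 0 < δ) :
    ∃ T, 0 ≤ T ∧ ‖shift T z - ContinuousMap.const ℝ≥0∞ (z ⊤)‖ < δ := by
  obtain ⟨T, hT⟩ := eventually_atTop.1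
    (((Metric.tendsto_nhds.1 (tendsto_traj z)) (δ / 2) (by positivity)).and (eventually_ge_atTop 0))
  have hT0 := (hT T le_rfl).2
  refine ⟨T, hT0, (norm_le_of_traj fun t ht => ?_).trans_lt (half_lt_self hδ)⟩
  rw [traj_sub, traj_shift hT0 z ht, ← dist_eq_norm]
  exact (hT _ (by linarith)).1.le

end LinearExistence

/-! ### Asymptotically hyperbolic linear equations -/

section AsymptoticallyHyperbolic

set_option linter.unusedSectionVars false

variable {E : Type*} [NormedAddCommGroup E] [NormedSpace ℝ E] [FiniteDimensional ℝ E]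
  {ι : Type*} [Fintype ι] {v : Module.Basis ι ℝ E} {μ : ι → ℝ}

/-- If `B(t)` tends to a hyperbolic diagonal operator then, for late times `T`, the equation
`ζ̇ = B ζ + g` has a unique convergent solution with prescribed stable part of `ζ(T)`. -/
lemma exists_bijective_linOp (hμ : ∀ i, μ i ≠ 0) {B : C(ℝ≥0∞, E →L[ℝ] E)}
    (hB : ∀ i, B ⊤ (v i) = μ i • v i) :
    ∃ T, Function.Bijective ((linOp B).prod ((stableCoord v μ).comp (evalAt E T))) := by
  obtain ⟨δ, hδ, hpert⟩ := bijective_linOp_of_norm_sub_lt (bijective_linOp_const hμ hB)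
  obtain ⟨T, hT0, hT⟩ := exists_norm_shift_sub_lt B hδ
  have hbij := hpert _ hT
  refine ⟨T, ?_, ?_⟩
  · rw [injective_iff_map_eq_zero]
    intro p hp
    have hp1 : linOp B p = 0 := congrArg Prod.fst hp
    have hp2 : stableCoord v μ (traj p.1.1 T) = 0 := congrArg Prod.snd hp
    have hder : ∀ t, 0 ≤ t →
        HasDerivWithinAt (traj p.1.1) (traj B t (traj p.1.1 t)) (Ici 0) t := by
      intro t ht
      simpa using hasDerivWithinAt_of_linOp_eq hp1 ht
    obtain ⟨q, hq, hqt⟩ := exists_linOp_eq (B := shift T B) (g := 0)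
      (y := fun t => traj p.1.1 (t + T)) (l := p.1.1 ⊤) (by
        intro t ht
        rw [traj_shift hT0 B ht, traj_zero, add_zero]
        have h1 := (hder (t + T) (by positivity)).scomp t
          (((hasDerivAt_id t).add_const T).hasDerivWithinAt (s := Ici 0))
          (fun s hs => add_nonneg hs hT0)
        simpa [Function.comp_def] using h1)
      ((tendsto_traj p.1.1).comp (tendsto_atTop_add_const_right _ _ tendsto_id))
    have hq0 : q = 0 := by
      refine hbij.1 ((Prod.ext hq ?_).trans (map_zero _).symm)
      change stableCoord v μ (traj q.1.1 0) = 0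
      rw [hqt 0 le_rfl, zero_add, hp2]
    have hpT : traj p.1.1 T = 0 := by
      have := hqt 0 le_rfl
      rw [zero_add] at this
      rw [← this, hq0]; rfl
    have hz : ∀ t, 0 ≤ t → traj p.1.1 t = 0 := by
      intro t ht
      rcases le_total t T with h | h
      · exact linear_ode_unique_left (continuous_traj B) hder hpT t ht h
      · have := hqt (t - T) (by linarith)
        rw [sub_add_cancel] at this
        rw [← this, hq0]; rfl
    have h1 : p.1.1 = 0 := ext_traj fun t ht => by simpa using hz t ht
    have h2 : p.1.2 = 0 := by
      rw [linOp_apply, h1, map_zero, sub_zero] at hp1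
      exact hp1
    exact Subtype.ext (Prod.ext h1 h2)
  · rintro ⟨g, ξ⟩
    obtain ⟨q, hq⟩ := hbij.2 (shift T g, ξ)
    have hq1 : linOp (shift T B) q = shift T g := congrArg Prod.fst hq
    have hq2 : stableCoord v μ (traj q.1.1 0) = ξ := congrArg Prod.snd hq
    obtain ⟨y, hyT, hy⟩ := exists_linear_ode_backward (continuous_traj B) (continuous_traj g) T
      (traj q.1.1 0)
    -- glue the solution before time `T` to the one after time `T`
    set Y : ℝ → E := fun t => if t ≤ T then y t else traj q.1.1 (t - T) with hY
    have hYle : ∀ t, t ≤ T → Y t = y t := fun t ht => if_pos ht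
    have hYge : ∀ t, T ≤ t → Y t = traj q.1.1 (t - T) := by
      intro t ht
      rcases ht.eq_or_lt with rfl | ht
      · rw [hYle _ le_rfl, hyT, sub_self]
      · exact if_neg ht.not_ge
    have hright : ∀ t, T ≤ t →
        HasDerivWithinAt Y (traj B t (Y t) + traj g t) (Ici T) t := by
      intro t ht
      have h1 := (hasDerivWithinAt_of_linOp_eq hq1 (sub_nonneg.2 ht)).scomp t
          (((hasDerivAt_id t).sub_const T).hasDerivWithinAt (s := Ici T))
          (fun s hs => sub_nonneg.2 hs)
      rw [traj_shift hT0 B (sub_nonneg.2 ht), traj_shift hT0 g (sub_nonneg.2 ht), sub_add_cancel,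
        one_smul, ← hYge t ht] at h1
      exact h1.congr (fun s hs => hYge s hs) (hYge t ht)
    have hleft : ∀ t ∈ Icc 0 T,
        HasDerivWithinAt Y (traj B t (Y t) + traj g t) (Icc 0 T) t := by
      intro t ht
      rw [hYle t ht.2]
      exact (hy t ht).congr (fun s hs => hYle s hs.2) (hYle t ht.2)
    have hder : ∀ t, 0 ≤ t →
        HasDerivWithinAt Y (traj B t (Y t) + traj g t) (Ici 0) t := by
      intro t ht
      rcases lt_trichotomy t T with h | rfl | h
      · refine (hleft t ⟨ht, h.le⟩).mono_of_mem_nhdsWithin ?_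
        rw [← Ici_inter_Iic]
        exact inter_mem_nhdsWithin _ (Iic_mem_nhds h)
      · rw [← Icc_union_Ici_eq_Ici ht]
        exact (hleft t ⟨ht, le_rfl⟩).union (hright t le_rfl)
      · exact ((hright t h.le).hasDerivAt (Ici_mem_nhds h)).hasDerivWithinAt
    have hlim : Tendsto Y atTop (𝓝 (q.1.1 ⊤)) := by
      refine ((tendsto_traj q.1.1).comp
        (tendsto_atTop_add_const_right _ (-T) tendsto_id)).congr' ?_
      filter_upwards [eventually_ge_atTop T] with t ht
      rw [hYge t ht]; rfl
    obtain ⟨p, hp, hpY⟩ := exists_linOp_eq hder hlim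
    refine ⟨p, Prod.ext hp ?_⟩
    change stableCoord v μ (traj p.1.1 T) = ξ
    rw [hpY T hT0, hYge T le_rfl, sub_self, hq2]

/-- The initial values of the decaying solutions of the linear equation `ζ̇ = B ζ`. -/
noncomputable def decaying (B : C(ℝ≥0∞, E →L[ℝ] E)) : Submodule ℝ E :=
  (LinearMap.ker (linOp B : diffSpace E →ₗ[ℝ] C(ℝ≥0∞, E))).map (evalAt E 0 : diffSpace E →ₗ[ℝ] E)

lemma mem_decaying {B : C(ℝ≥0∞, E →L[ℝ] E)} {x : E} :
    x ∈ decaying B ↔ ∃ p : diffSpace E, linOp B p = 0 ∧ traj p.1.1 0 = x := Iff.rfl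

lemma eq_zero_of_linOp_eq_zero {B : C(ℝ≥0∞, E →L[ℝ] E)} {p : diffSpace E}
    (hp : linOp B p = 0) (h0 : traj p.1.1 0 = 0) : p = 0 := by
  have h1 : p.1.1 = 0 := ext_traj fun t ht => by
    refine linear_ode_unique (continuous_traj B) (T := 0) (fun t ht => ?_) h0 t ht
    simpa using hasDerivWithinAt_of_linOp_eq hp ht
  have h2 : p.1.2 = 0 := by
    rw [linOp_apply, h1, map_zero, sub_zero] at hp
    exact hp
  exact Subtype.ext (Prod.ext h1 h2)

lemma finrank_decaying (hμ : ∀ i, μ i ≠ 0) {B : C(ℝ≥0∞, E →L[ℝ] E)}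
    (hB : ∀ i, B ⊤ (v i) = μ i • v i) :
    Module.finrank ℝ (decaying B) = Nat.card {i // μ i < 0} := by
  classical
  obtain ⟨T, hT⟩ := exists_bijective_linOp hμ hB
  set N := LinearMap.ker (linOp B : diffSpace E →ₗ[ℝ] C(ℝ≥0∞, E))
  have h1 : Module.finrank ℝ (decaying B) = Module.finrank ℝ N := by
    have hinj : Function.Injective ((evalAt E 0 : diffSpace E →ₗ[ℝ] E).domRestrict N) := by
      rw [injective_iff_map_eq_zero]
      exact fun p hp => Subtype.ext (eq_zero_of_linOp_eq_zero p.2 hp)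
    rw [← LinearMap.finrank_range_of_inj hinj, LinearMap.range_domRestrict]
    rfl
  let e : N →ₗ[ℝ] ({i // μ i < 0} → ℝ) :=
    ((stableCoord v μ).comp (evalAt E T) : diffSpace E →ₗ[ℝ] _).domRestrict N
  have he : Function.Bijective e := by
    constructor
    · rw [injective_iff_map_eq_zero]
      intro p hp
      refine Subtype.ext (hT.1 ((Prod.ext ?_ ?_).trans (map_zero _).symm))
      · exact p.2
      · exact hp
    · intro ξ
      obtain ⟨p, hp⟩ := hT.2 (0, ξ)
      exact ⟨⟨p, congrArg Prod.fst hp⟩, congrArg Prod.snd hp⟩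
  rw [h1, (LinearEquiv.ofBijective e he).finrank_eq, Module.finrank_fintype_fun_eq_card,
    Nat.card_eq_fintype_card]

/-- The equation `ζ̇ = B ζ + g` has a unique convergent solution for which `ζ(0)` has a prescribed
projection to the space of initial values of decaying solutions. -/
lemma bijective_linOp_decaying (hμ : ∀ i, μ i ≠ 0) {B : C(ℝ≥0∞, E →L[ℝ] E)}
    (hB : ∀ i, B ⊤ (v i) = μ i • v i) {P : E →L[ℝ] decaying B}
    (hP : ∀ x : decaying B, P x = x) :
    Function.Bijective ((linOp B).prod (P.comp (evalAt E 0))) := by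
  obtain ⟨T, hT⟩ := exists_bijective_linOp hμ hB
  constructor
  · rw [injective_iff_map_eq_zero]
    intro p hp
    have hp1 : linOp B p = 0 := congrArg Prod.fst hp
    have hp2 : P (traj p.1.1 0) = 0 := congrArg Prod.snd hp
    refine eq_zero_of_linOp_eq_zero hp1 ?_
    have := hP ⟨traj p.1.1 0, p, hp1, rfl⟩
    rw [hp2] at this
    exact congrArg Subtype.val this.symm
  · rintro ⟨g, x⟩
    obtain ⟨p, hp⟩ := hT.2 (g, 0)
    have hp1 : linOp B p = g := congrArg Prod.fst hp
    obtain ⟨q, hq, hqx⟩ := mem_decaying.1 (x - P (traj p.1.1 0)).2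
    refine ⟨p + q, Prod.ext ?_ ?_⟩
    · change linOp B (p + q) = g
      rw [map_add, hp1, hq, add_zero]
    · change P (traj p.1.1 0 + traj q.1.1 0) = x
      rw [hqx, map_add, hP, add_sub_cancel]

end AsymptoticallyHyperbolic

/-! ### Inverse function theorem, graphs and tangent spaces -/

section Submanifolds

/-- The inverse function theorem, for a map that is smooth everywhere. -/
lemma exists_smooth_localInverse {X Y : Type*} [NormedAddCommGroup X] [NormedSpace ℝ X]
    [CompleteSpace X] [NormedAddCommGroup Y] [NormedSpace ℝ Y] [CompleteSpace Y] {Θ : X → Y}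
    (hΘ : ContDiff ℝ ∞ Θ) {Θ' : X →L[ℝ] Y} {a : X} (hΘ' : HasFDerivAt Θ Θ' a)
    (hbij : Function.Bijective Θ') :
    ∃ Φ : OpenPartialHomeomorph X Y, a ∈ Φ.source ∧ (∀ x, Φ x = Θ x) ∧
      ContDiffOn ℝ ∞ Φ.symm Φ.target := by
  set e := ContinuousLinearEquiv.ofBijective Θ'
    (LinearMap.ker_eq_bot.2 hbij.1) (LinearMap.range_eq_top.2 hbij.2)
  have he : HasFDerivAt Θ (e : X →L[ℝ] Y) a := by
    rwa [show (e : X →L[ℝ] Y) = Θ' from ContinuousLinearMap.ext fun x => rfl]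
  set Φ := hΘ.contDiffAt.toOpenPartialHomeomorph Θ he (by simp)
  have ha : a ∈ Φ.source := hΘ.contDiffAt.mem_toOpenPartialHomeomorph_source he (by simp)
  have hderc : Continuous (fderiv ℝ Θ) := hΘ.continuous_fderiv (by simp)
  set s : Set X := fderiv ℝ Θ ⁻¹' range ((↑) : (X ≃L[ℝ] Y) → X →L[ℝ] Y)
  have hs : IsOpen s := (ContinuousLinearEquiv.isOpen).preimage hderc
  have has : a ∈ s := ⟨e, he.fderiv.symm⟩
  refine ⟨Φ.restrOpen s hs, ⟨ha, has⟩, fun x => rfl, fun y hy => ?_⟩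
  have hsy := (Φ.restrOpen s hs).map_target hy
  obtain ⟨e', he'⟩ := hsy.2
  refine ((Φ.restrOpen s hs).contDiffAt_symm hy (f₀' := e') ?_ hΘ.contDiffAt).contDiffWithinAt
  rw [he']
  exact (hΘ.differentiable (by simp) _).hasFDerivAt

variable {E : Type*} [NormedAddCommGroup E] [NormedSpace ℝ E]

/-- The graph of a smooth section of a linear projection, over an open set, is a submanifold. -/
lemma isSubmanifold_graph {L : Submodule ℝ E} {P : E →L[ℝ] L}
    (hP : ∀ x : L, P x = x) {O : Set L} (hO : IsOpen O) {s : L → E} (hs : ContDiffOn ℝ ∞ s O)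
    (hPs : ∀ l ∈ O, P (s l) = l) :
    IsSubmanifold (Module.finrank ℝ L) {q | P q ∈ O ∧ q = s (P q)} := by
  intro q hq
  have hsub : ContDiffOn ℝ ∞ (fun x => s (P x) - (P x : E)) (P ⁻¹' O) := by
    refine ContDiffOn.sub (hs.comp P.contDiff.contDiffOn fun x hx => hx) ?_
    exact (L.subtypeL.contDiff.comp P.contDiff).contDiffOn
  have hPd : ∀ x, P x ∈ O → P (s (P x) - (P x : E)) = 0 := by
    intro x hx
    rw [map_sub, hPs _ hx, hP, sub_self]
  have h1 : ContDiffOn ℝ ∞ (fun x => x - (s (P x) - (P x : E))) (P ⁻¹' O) :=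
    contDiffOn_id.sub hsub
  have h2 : ContDiffOn ℝ ∞ (fun x => x + (s (P x) - (P x : E))) (P ⁻¹' O) :=
    contDiffOn_id.add hsub
  have hPm : ∀ x, P x ∈ O → P (x - (s (P x) - (P x : E))) = P x := by
    intro x hx; rw [map_sub, hPd x hx, sub_zero]
  have hPp : ∀ x, P x ∈ O → P (x + (s (P x) - (P x : E))) = P x := by
    intro x hx; rw [map_add, hPd x hx, add_zero]
  let Φ : OpenPartialHomeomorph E E :=
    { toFun := fun x => x - (s (P x) - (P x : E))
      invFun := fun x => x + (s (P x) - (P x : E))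
      source := P ⁻¹' O
      target := P ⁻¹' O
      map_source' := fun x hx => by
        rw [mem_preimage] at hx ⊢; rwa [hPm x hx]
      map_target' := fun x hx => by
        rw [mem_preimage] at hx ⊢; rwa [hPp x hx]
      left_inv' := fun x hx => by simp only [hPm x hx]; abel
      right_inv' := fun x hx => by simp only [hPp x hx]; abel
      open_source := hO.preimage P.continuous
      open_target := hO.preimage P.continuous
      continuousOn_toFun := h1.continuousOn
      continuousOn_invFun := h2.continuousOn }
  refine ⟨hq, Φ, L, hq.1, h1, h2, rfl, fun x hx => ?_⟩
  have hx' : P x ∈ O := hx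
  change (P x ∈ O ∧ x = s (P x)) ↔ x - (s (P x) - (P x : E)) ∈ L
  constructor
  · rintro ⟨-, h⟩
    have : x - (s (P x) - (P x : E)) = P x := by rw [← h]; abel
    rw [this]
    exact (P x).2
  · intro h
    refine ⟨hx', ?_⟩
    have h3 := congrArg (Subtype.val) (hP ⟨_, h⟩)
    simp only [hPm x hx'] at h3
    rw [eq_sub_iff_add_eq, add_comm, sub_add_cancel] at h3
    exact h3.symm

/-- An embedded submanifold has a linear tangent space of the right dimension. -/
lemma IsSubmanifoldAt.exists_tangentSet_eq [FiniteDimensional ℝ E] {k : ℕ} {S : Set E} {q : E}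
    (h : IsSubmanifoldAt k S q) :
    ∃ W : Submodule ℝ E, Module.finrank ℝ W = k ∧ tangentSet S q = W := by
  obtain ⟨hq, Φ, V, hqs, h1, h2, hk, hS⟩ := h
  have hΦ : ContDiffAt ℝ ∞ Φ q := h1.contDiffAt (Φ.open_source.mem_nhds hqs)
  have hΨ : ContDiffAt ℝ ∞ Φ.symm (Φ q) :=
    h2.contDiffAt (Φ.open_target.mem_nhds (Φ.map_source hqs))
  set a := fderiv ℝ Φ q
  set b := fderiv ℝ Φ.symm (Φ q)
  have ha : HasFDerivAt Φ a q := (hΦ.differentiableAt (by simp)).hasFDerivAt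
  have hb : HasFDerivAt Φ.symm b (Φ q) := (hΨ.differentiableAt (by simp)).hasFDerivAt
  have hba : b.comp a = ContinuousLinearMap.id ℝ E := by
    refine (hb.comp q ha).unique ((hasFDerivAt_id q).congr_of_eventuallyEq ?_)
    filter_upwards [Φ.open_source.mem_nhds hqs] with x hx using Φ.left_inv hx
  have hab : a.comp b = ContinuousLinearMap.id ℝ E := by
    have ha' : HasFDerivAt Φ a (Φ.symm (Φ q)) := by rwa [Φ.left_inv hqs]
    refine (ha'.comp (Φ q) hb).unique ((hasFDerivAt_id _).congr_of_eventuallyEq ?_)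
    filter_upwards [Φ.open_target.mem_nhds (Φ.map_source hqs)] with x hx using Φ.right_inv hx
  have hinj : Function.Injective (b : E →ₗ[ℝ] E) :=
    Function.LeftInverse.injective (g := a) fun x => by simpa using congrArg (· x) hab
  refine ⟨V.map (b : E →ₗ[ℝ] E), ?_, ?_⟩
  · rw [← hk]
    exact ((Submodule.equivMapOfInjective _ hinj V).finrank_eq).symm
  · ext w
    constructor
    · rintro ⟨γ, -, hγ0, hγ', hγS⟩
      have hγt : Tendsto γ (𝓝 0) (𝓝 q) := by
        have := hγ'.continuousAt.tendsto
        rwa [hγ0] at this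
      have hder : HasDerivAt (Φ ∘ γ) (a w) 0 := by
        have ha' : HasFDerivAt Φ a (γ 0) := by rwa [hγ0]
        exact ha'.comp_hasDerivAt 0 hγ'
      have hΦγ : ∀ᶠ r in 𝓝 (0 : ℝ), (Φ ∘ γ) r ∈ V := by
        filter_upwards [hγS, hγt.eventually (Φ.open_source.mem_nhds hqs)] with r h3 h4
        exact (hS _ h4).1 h3
      have hclosed : IsClosed (V : Set E) := V.closed_of_finiteDimensional
      have haV : a w ∈ V := by
        have h5 := hder.tendsto_slope
        refine hclosed.mem_of_tendsto h5 ?_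
        filter_upwards [nhdsWithin_le_nhds hΦγ] with r hr
        rw [slope_def_module]
        exact V.smul_mem _ (V.sub_mem hr hΦγ.self_of_nhds)
      exact ⟨a w, haV, by simpa using congrArg (· w) hba⟩
    · rintro ⟨v, hv, rfl⟩
      have hlin : HasDerivAt (fun r : ℝ => Φ q + r • v) v 0 := by
        simpa using ((hasDerivAt_id (0 : ℝ)).smul_const v).const_add (Φ q)
      have hlin0 : Φ q + (0 : ℝ) • v = Φ q := by simp
      refine ⟨fun r => Φ.symm (Φ q + r • v), ?_, ?_, ?_, ?_⟩
      · refine ContDiffAt.comp (0 : ℝ) (by rwa [hlin0]) ?_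
        fun_prop
      · simpa using Φ.left_inv hqs
      · have hb' : HasFDerivAt Φ.symm b (Φ q + (0 : ℝ) • v) := by rwa [hlin0]
        exact hb'.comp_hasDerivAt 0 hlin
      · have ht : ∀ᶠ r : ℝ in 𝓝 0, Φ q + r • v ∈ Φ.target := by
          have h6 := hlin.continuousAt.tendsto
          rw [hlin0] at h6
          exact h6.eventually (Φ.open_target.mem_nhds (Φ.map_source hqs))
        filter_upwards [ht] with r hr
        rw [hS _ (Φ.map_target hr), Φ.right_inv hr]
        exact V.add_mem ((hS q hqs).1 hq) (V.smul_mem r hv)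

lemma IsSubmanifoldAt.dim_unique [FiniteDimensional ℝ E] {k l : ℕ} {S : Set E} {q : E}
    (hk : IsSubmanifoldAt k S q) (hl : IsSubmanifoldAt l S q) : k = l := by
  obtain ⟨W, rfl, hW⟩ := hk.exists_tangentSet_eq
  obtain ⟨W', rfl, hW'⟩ := hl.exists_tangentSet_eq
  rw [SetLike.coe_injective (hW.symm.trans hW')]

end Submanifolds

/-! ### Converging solutions -/

section ConvergingSolutions

set_option linter.unusedSectionVars false

variable {E : Type*} [NormedAddCommGroup E] [NormedSpace ℝ E]

/-- A convergent function whose derivative converges has derivative tending to zero. -/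
lemma snd_top_eq_zero (p : diffSpace E) : p.1.2 ⊤ = 0 := by
  set w := p.1.2 ⊤
  have hstep : Tendsto (fun t => traj p.1.1 (t + 1) - traj p.1.1 t) atTop (𝓝 0) := by
    have h1 := (tendsto_traj p.1.1).comp (tendsto_atTop_add_const_right _ (1 : ℝ) tendsto_id)
    simpa using h1.sub (tendsto_traj p.1.1)
  have hstep' : Tendsto (fun t => traj p.1.1 (t + 1) - traj p.1.1 t) atTop (𝓝 w) := by
    rw [Metric.tendsto_nhds]
    intro ε hε
    obtain ⟨T, hT⟩ := eventually_atTop.1 (((Metric.tendsto_nhds.1 (tendsto_traj p.1.2)) (ε / 2)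
      (by positivity)).and (eventually_ge_atTop 0))
    filter_upwards [eventually_ge_atTop T] with t ht
    have ht0 : 0 ≤ t := (hT t ht).2
    have hder : ∀ s ∈ Icc t (t + 1), HasDerivWithinAt (fun s => traj p.1.1 s - s • w)
        (traj p.1.2 s - (1 : ℝ) • w) (Icc t (t + 1)) s := by
      intro s hs
      exact ((p.2 s (ht0.trans hs.1)).mono (fun r hr => ht0.trans hr.1)).sub
        ((hasDerivWithinAt_id s _).smul_const w)
    have h2 := (convex_Icc t (t + 1)).norm_image_sub_le_of_norm_hasDerivWithin_le hder
      (C := ε / 2) (fun s hs => by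
        rw [one_smul, ← dist_eq_norm]
        exact (hT s (ht.trans hs.1)).1.le) (left_mem_Icc.2 (by linarith))
      (right_mem_Icc.2 (by linarith))
    have h3 : traj p.1.1 (t + 1) - (t + 1) • w - (traj p.1.1 t - t • w)
        = traj p.1.1 (t + 1) - traj p.1.1 t - w := by
      rw [add_smul, one_smul]; abel
    rw [h3] at h2
    rw [dist_eq_norm]
    refine h2.trans_lt ?_
    simp
    exact hε
  exact tendsto_nhds_unique hstep' hstep

lemma integralCurve_unique [FiniteDimensional ℝ E] {F : E → E} (hF : ContDiff ℝ ∞ F)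
    {x y : ℝ → E} (hx : IsIntegralCurveOn x (fun _ => F) (Ici 0))
    (hy : IsIntegralCurveOn y (fun _ => F) (Ici 0)) (h0 : x 0 = y 0) :
    ∀ t, 0 ≤ t → x t = y t := by
  intro t ht
  have hxc : ContinuousOn x (Icc 0 t) := fun s hs =>
    ((hx s hs.1).continuousWithinAt).mono Icc_subset_Ici_self
  have hyc : ContinuousOn y (Icc 0 t) := fun s hs =>
    ((hy s hs.1).continuousWithinAt).mono Icc_subset_Ici_self
  obtain ⟨Rx, hRx⟩ := isCompact_Icc.exists_bound_of_continuousOn hxc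
  obtain ⟨Ry, hRy⟩ := isCompact_Icc.exists_bound_of_continuousOn hyc
  set R := max Rx Ry
  obtain ⟨C, hC⟩ := (isCompact_closedBall (0 : E) R).exists_bound_of_continuousOn
    (hF.continuous_fderiv (by simp)).continuousOn
  have := eq_zero_of_abs_deriv_le_mul_abs_self_of_eq_zero_right (f := fun s => x s - y s)
    (f' := fun s => F (x s) - F (y s)) (K := C) (a := 0) (b := t) (hxc.sub hyc)
    (fun s hs => ((hx s hs.1).sub (hy s hs.1)).mono (Ici_subset_Ici.2 hs.1)) (by simp [h0])
    (fun s hs => (convex_closedBall (0 : E) R).norm_image_sub_le_of_norm_fderiv_le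
      (fun z _ => hF.differentiable (by simp) z) hC
      (mem_closedBall_zero_iff.2 <| (hRy s ⟨hs.1, hs.2.le⟩).trans (le_max_right Rx Ry))
      (mem_closedBall_zero_iff.2 <| (hRx s ⟨hs.1, hs.2.le⟩).trans (le_max_left Rx Ry))) t ⟨ht, le_rfl⟩
  exact sub_eq_zero.1 this

/-- A converging solution, as a point of the Banach space `C([0, ∞], E)`. -/
lemma IsConvergingSolution.exists_traj {F : E → E} {e p : E} {x : ℝ → E}
    (hx : IsConvergingSolution F e p x) :
    ∃ z : C(ℝ≥0∞, E), z ⊤ = e ∧ (∀ t, 0 ≤ t → traj z t = x t) :=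
  exists_traj_eq (fun t ht => (hx.1 t ht).continuousWithinAt) hx.2.2

lemma mem_diffSpace_of_solution {F : C(E, E)} {e p : E} {x : ℝ → E}
    (hx : IsConvergingSolution F e p x) {z : C(ℝ≥0∞, E)} (hz : ∀ t, 0 ≤ t → traj z t = x t) :
    (z, F.comp z) ∈ diffSpace E := by
  intro t ht
  have h1 : traj (F.comp z) t = F (x t) := by rw [← hz t ht]; rfl
  simp only [h1]
  exact (hx.1 t ht).congr (fun s hs => hz s hs) (hz t ht)

lemma isConvergingSolution_traj {F : C(E, E)} {p : diffSpace E} (hp : p.1.2 = F.comp p.1.1) :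
    IsConvergingSolution F (p.1.1 ⊤) (traj p.1.1 0) (traj p.1.1) := by
  refine ⟨fun t ht => ?_, rfl, tendsto_traj _⟩
  have h1 := p.2 t ht
  rw [hp] at h1
  exact h1

end ConvergingSolutions

/-! ### The stable manifold theorem -/

section StableManifold

set_option linter.unusedSectionVars false

universe u

variable {E : Type u} [NormedAddCommGroup E] [NormedSpace ℝ E] [FiniteDimensional ℝ E]
  {ι : Type*} [Fintype ι] {v : Module.Basis ι ℝ E} {μ : ι → ℝ} {F : E → E} {e p : E}

lemma exists_isolated_zero (hF : ContDiff ℝ ∞ F) (he : F e = 0)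
    (hμ : ∀ i, μ i ≠ 0) (hv : ∀ i, fderiv ℝ F e (v i) = μ i • v i) :
    ∃ ρ > 0, ∀ y, dist y e < ρ → F y = 0 → y = e := by
  have hinj : Function.Injective (fderiv ℝ F e) := by
    rw [injective_iff_map_eq_zero]
    intro x hx
    refine v.ext_elem fun i => ?_
    have := repr_apply_of_eigen hv x i
    rw [hx] at this
    simpa [hμ i] using this
  have hsurj : Function.Surjective (fderiv ℝ F e) :=
    LinearMap.injective_iff_surjective (f := (fderiv ℝ F e : E →ₗ[ℝ] E)).1 hinj
  obtain ⟨Φ, hΦe, hΦ, -⟩ := exists_smooth_localInverse hF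
    (hF.differentiable (by simp) e).hasFDerivAt ⟨hinj, hsurj⟩
  obtain ⟨ρ, hρ, hball⟩ := Metric.mem_nhds_iff.1 (Φ.open_source.mem_nhds hΦe)
  exact ⟨ρ, hρ, fun y hy hy0 => Φ.injOn (hball hy) hΦe (by rw [hΦ, hΦ, hy0, he])⟩

/-- The coefficient of the equation linearized along `z`. -/
noncomputable def linearization (hF : ContDiff ℝ ∞ F) (z : C(ℝ≥0∞, E)) : C(ℝ≥0∞, E →L[ℝ] E) :=
  (⟨fderiv ℝ F, hF.continuous_fderiv (by simp)⟩ : C(E, E →L[ℝ] E)).comp z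

/-- The map `w ↦ (ẇ - F(w), P w(0))`. The converging solutions of `ẋ = F(x)` are the `w` at which
its first component vanishes; the second one is a coordinate on the set of these solutions. -/
noncomputable def solutionMap (F : C(E, E)) {L : Submodule ℝ E} (P : E →L[ℝ] L)
    (w : diffSpace E) : C(ℝ≥0∞, E) × L :=
  (w.1.2 - F.comp w.1.1, P (traj w.1.1 0))

lemma contDiff_solutionMap (hF : ContDiff ℝ ∞ F) {L : Submodule ℝ E} (P : E →L[ℝ] L) :
    ContDiff ℝ ∞ (solutionMap ⟨F, hF.continuous⟩ P) := by
  have h1 : ContDiff ℝ ∞ (fun w : diffSpace E => w.1.1) :=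
    ((ContinuousLinearMap.fst ℝ _ _).comp (diffSpace E).subtypeL).contDiff
  have h2 : ContDiff ℝ ∞ (fun w : diffSpace E => w.1.2) :=
    ((ContinuousLinearMap.snd ℝ _ _).comp (diffSpace E).subtypeL).contDiff
  exact (h2.sub ((contDiff_superposition _ hF).comp h1)).prodMk (P.comp (evalAt E 0)).contDiff

lemma hasFDerivAt_solutionMap (hF : ContDiff ℝ ∞ F) {L : Submodule ℝ E} (P : E →L[ℝ] L)
    (w : diffSpace E) :
    HasFDerivAt (solutionMap ⟨F, hF.continuous⟩ P)
      ((linOp (linearization hF w.1.1)).prod (P.comp (evalAt E 0))) w := by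
  have h1 : HasFDerivAt (fun w : diffSpace E => w.1.1)
      ((ContinuousLinearMap.fst ℝ _ _).comp (diffSpace E).subtypeL) w :=
    ((ContinuousLinearMap.fst ℝ _ _).comp (diffSpace E).subtypeL).hasFDerivAt
  have h2 : HasFDerivAt (fun w : diffSpace E => w.1.2)
      ((ContinuousLinearMap.snd ℝ _ _).comp (diffSpace E).subtypeL) w :=
    ((ContinuousLinearMap.snd ℝ _ _).comp (diffSpace E).subtypeL).hasFDerivAt
  have h3 := hasFDerivAt_superposition (K := ℝ≥0∞) ⟨F, hF.continuous⟩
    ⟨fderiv ℝ F, hF.continuous_fderiv (by simp)⟩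
    (fun y => (hF.differentiable (by simp) y).hasFDerivAt) w.1.1
  exact (h2.sub (h3.comp w h1)).prodMk (P.comp (evalAt E 0)).hasFDerivAt

/-- Small plaques of the stable manifold of a hyperbolic equilibrium are graphs over open subsets
of the space of initial values of decaying solutions of the linearized equation, and are tangent
to that space at their centre. -/
lemma exists_plaque_eq_graph (hF : ContDiff ℝ ∞ F) (he : F e = 0)
    (hμ : ∀ i, μ i ≠ 0) (hv : ∀ i, fderiv ℝ F e (v i) = μ i • v i)
    {x : ℝ → E} (hx : IsConvergingSolution F e p x) {z : C(ℝ≥0∞, E)} (hze : z ⊤ = e)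
    (hz : ∀ t, 0 ≤ t → traj z t = x t) {B : C(ℝ≥0∞, E →L[ℝ] E)} (hBz : B = linearization hF z)
    {P : E →L[ℝ] decaying B} (hP : ∀ l : decaying B, P l = l) :
    ∃ s : decaying B → E, ∃ ε₀ > 0, ∀ ε, 0 < ε → ε ≤ ε₀ →
      ∃ O : Set (decaying B), IsOpen O ∧ ContDiffOn ℝ ∞ s O ∧
        (∀ l ∈ O, P (s l) = l) ∧ P p ∈ O ∧ s (P p) = p ∧
        stablePlaque F e p ε = {q | P q ∈ O ∧ q = s (P q)} ∧
        ∀ l : decaying B, HasDerivAt (fun r : ℝ => s (P p + r • l)) l 0 := by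
  set Fc : C(E, E) := ⟨F, hF.continuous⟩
  have hB : ∀ i, B ⊤ (v i) = μ i • v i := by
    intro i
    rw [hBz]
    change fderiv ℝ F (z ⊤) (v i) = _
    rw [hze, hv]
  set w₀ : diffSpace E := ⟨(z, Fc.comp z), mem_diffSpace_of_solution hx hz⟩ with hw₀
  set Θ := solutionMap Fc P
  have hzp : traj z 0 = p := by rw [hz 0 le_rfl, hx.2.1]
  have hΘw₀ : Θ w₀ = (0, P p) := by
    refine Prod.ext (sub_self _) ?_
    change P (traj z 0) = P p
    rw [hzp]
  have hΘ' : HasFDerivAt Θ ((linOp B).prod (P.comp (evalAt E 0))) w₀ := by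
    have h1 := hasFDerivAt_solutionMap hF P w₀
    rwa [show linearization hF w₀.1.1 = B from hBz.symm] at h1
  obtain ⟨Φ, hΦw₀, hΦ, hΦs⟩ := exists_smooth_localInverse (contDiff_solutionMap hF P) hΘ'
    (bijective_linOp_decaying hμ hB hP)
  replace hΦ : ∀ w, Φ w = Θ w := hΦ
  obtain ⟨ρ, hρ, hiso⟩ := exists_isolated_zero hF he hμ hv
  -- solutions that are uniformly close to `z` lie in the domain of the local inverse
  obtain ⟨U, hU, hUs⟩ := isOpen_induced_iff.1 Φ.open_source
  have hgraph : Continuous fun y : C(ℝ≥0∞, E) => (y, Fc.comp y) :=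
    continuous_id.prodMk (ContinuousMap.continuous_postcomp Fc)
  have hnhds : (fun y : C(ℝ≥0∞, E) => (y, Fc.comp y)) ⁻¹' U ∈ 𝓝 z := by
    refine (hU.preimage hgraph).mem_nhds ?_
    change w₀ ∈ Subtype.val ⁻¹' U
    rwa [hUs]
  obtain ⟨ε₁, hε₁, hball⟩ := Metric.mem_nhds_iff.1 hnhds
  have hcl : ContDiffOn ℝ ∞ (fun l => Φ.symm ((0 : C(ℝ≥0∞, E)), l))
      {l | ((0 : C(ℝ≥0∞, E)), l) ∈ Φ.target} :=
    hΦs.comp (contDiff_const.prodMk contDiff_id).contDiffOn fun l hl => hl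
  have hTopen : IsOpen {l | ((0 : C(ℝ≥0∞, E)), l) ∈ Φ.target} :=
    Φ.open_target.preimage (continuous_const.prodMk continuous_id)
  have hevs : ContDiffOn ℝ ∞ (fun l => evalAt E 0 (Φ.symm ((0 : C(ℝ≥0∞, E)), l)))
      {l | ((0 : C(ℝ≥0∞, E)), l) ∈ Φ.target} :=
    (evalAt E 0).contDiff.comp_contDiffOn hcl
  have hsymm : ∀ l, ((0 : C(ℝ≥0∞, E)), l) ∈ Φ.target →
      (Φ.symm (0, l)).1.2 = Fc.comp (Φ.symm (0, l)).1.1 ∧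
        P (traj (Φ.symm (0, l)).1.1 0) = l := by
    intro l hl
    have h1 : Θ (Φ.symm (0, l)) = (0, l) := by rw [← hΦ, Φ.right_inv hl]
    exact ⟨sub_eq_zero.1 (congrArg Prod.fst h1), congrArg Prod.snd h1⟩
  have hPp : ((0 : C(ℝ≥0∞, E)), P p) ∈ Φ.target := by
    rw [← hΘw₀, ← hΦ]; exact Φ.map_source hΦw₀
  have hPp' : Φ.symm ((0 : C(ℝ≥0∞, E)), P p) = w₀ := by
    rw [← hΘw₀, ← hΦ, Φ.left_inv hΦw₀]
  refine ⟨fun l => evalAt E 0 (Φ.symm (0, l)), min ε₁ ρ, lt_min hε₁ hρ, fun ε hε hεle => ?_⟩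
  set O := {l | ((0 : C(ℝ≥0∞, E)), l) ∈ Φ.target} ∩
    (fun l => (Φ.symm ((0 : C(ℝ≥0∞, E)), l)).1.1) ⁻¹' Metric.ball z ε with hO
  have hOopen : IsOpen O := by
    refine ContinuousOn.isOpen_inter_preimage ?_ hTopen Metric.isOpen_ball
    exact (continuous_fst.comp continuous_subtype_val).comp_continuousOn hcl.continuousOn
  have hsp : evalAt E 0 (Φ.symm ((0 : C(ℝ≥0∞, E)), P p)) = p := by
    rw [hPp']; exact hzp
  refine ⟨O, hOopen, hevs.mono inter_subset_left, fun l hl => (hsymm l hl.1).2,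
    ⟨hPp, ?_⟩, hsp, ?_, ?_⟩
  · rw [mem_preimage, hPp']
    exact Metric.mem_ball_self hε
  · ext q
    constructor
    · rintro ⟨x', y, hx', hy, hxy⟩
      obtain ⟨zy, hzye, hzy⟩ := hy.exists_traj
      have hxx' : ∀ t, 0 ≤ t → x' t = x t :=
        integralCurve_unique hF hx'.1 hx.1 (hx'.2.1.trans hx.2.1.symm)
      have hdist : zy ∈ Metric.ball z ε := by
        rw [Metric.mem_ball, ContinuousMap.dist_lt_iff hε]
        intro r
        induction r using ENNReal.recTopCoe with
        | top => rw [hzye, hze, dist_self]; exact hε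
        | coe r =>
          have h1 := hxy r r.2
          rw [hxx' r r.2, ← hz r r.2, ← hzy r r.2, dist_comm] at h1
          simpa [traj] using h1
      set wy : diffSpace E := ⟨(zy, Fc.comp zy), mem_diffSpace_of_solution hy hzy⟩
      have hwy : wy ∈ Φ.source := by
        rw [← hUs]
        exact hball (Metric.ball_subset_ball (hεle.trans (min_le_left _ _)) hdist)
      have hyq : traj zy 0 = q := by rw [hzy 0 le_rfl, hy.2.1]
      have hΘwy : Θ wy = (0, P q) := by
        refine Prod.ext (sub_self _) ?_
        change P (traj zy 0) = P q
        rw [hyq]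
      have hinv : Φ.symm ((0 : C(ℝ≥0∞, E)), P q) = wy := by
        rw [← hΘwy, ← hΦ, Φ.left_inv hwy]
      refine ⟨⟨?_, ?_⟩, ?_⟩
      · change ((0 : C(ℝ≥0∞, E)), P q) ∈ Φ.target
        rw [← hΘwy, ← hΦ]; exact Φ.map_source hwy
      · rw [mem_preimage, hinv]; exact hdist
      · change q = evalAt E 0 (Φ.symm (0, P q))
        rw [hinv]; exact hyq.symm
    · rintro ⟨⟨hq1, hq2⟩, hq3⟩
      set w := Φ.symm ((0 : C(ℝ≥0∞, E)), P q)
      obtain ⟨hw, -⟩ := hsymm _ hq1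
      have hdist : dist w.1.1 z < ε := hq2
      -- the limit of the solution is an equilibrium close to `e`, hence is `e`
      have hlim : w.1.1 ⊤ = e := by
        refine hiso _ ?_ ?_
        · rw [← hze]
          exact (ContinuousMap.dist_apply_le_dist _).trans_lt
            (hdist.trans_le (hεle.trans (min_le_right _ _)))
        · have h1 := snd_top_eq_zero w
          rw [hw] at h1
          exact h1
      have hsol := isConvergingSolution_traj hw
      rw [hlim] at hsol
      have hq4 : traj w.1.1 0 = q := hq3.symm
      rw [hq4] at hsol
      refine ⟨x, traj w.1.1, hx, hsol, fun t ht => ?_⟩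
      rw [← hz t ht, dist_comm]
      exact (ContinuousMap.dist_apply_le_dist _).trans_lt hdist
  · intro l
    have hline : HasDerivAt (fun r : ℝ => P p + r • l) l 0 := by
      simpa using ((hasDerivAt_id (0 : ℝ)).smul_const l).const_add (P p)
    have hline0 : P p + (0 : ℝ) • l = P p := by simp
    have hσ : DifferentiableAt ℝ (fun l => Φ.symm ((0 : C(ℝ≥0∞, E)), l)) (P p + (0 : ℝ) • l) := by
      rw [hline0]
      exact (hcl.contDiffAt (hTopen.mem_nhds hPp)).differentiableAt (by simp)
    obtain ⟨ζ, hζ⟩ : ∃ ζ, HasDerivAt (fun r : ℝ => Φ.symm ((0 : C(ℝ≥0∞, E)), P p + r • l)) ζ 0 := by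
      have h := hσ.hasFDerivAt.comp_hasDerivAt (0 : ℝ) hline
      exact ⟨_, h⟩
    -- differentiate the equation `Θ (σ (P p + r l)) = (0, P p + r l)`
    have h1 : HasDerivAt (fun r : ℝ => Θ (Φ.symm ((0 : C(ℝ≥0∞, E)), P p + r • l)))
        (((linOp B).prod (P.comp (evalAt E 0))) ζ) 0 := by
      have h8 : HasFDerivAt Θ ((linOp B).prod (P.comp (evalAt E 0)))
          (Φ.symm ((0 : C(ℝ≥0∞, E)), P p + (0 : ℝ) • l)) := by
        rwa [hline0, hPp']
      exact h8.comp_hasDerivAt (0 : ℝ) hζ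
    have h2 : HasDerivAt (fun r : ℝ => ((0 : C(ℝ≥0∞, E)), P p + r • l)) (0, l) 0 :=
      (hasDerivAt_const _ _).prodMk hline
    have h3 : ((linOp B).prod (P.comp (evalAt E 0))) ζ = (0, l) := by
      refine h1.unique (h2.congr_of_eventuallyEq ?_)
      have ht : ∀ᶠ r : ℝ in 𝓝 0, P p + r • l ∈ {l | ((0 : C(ℝ≥0∞, E)), l) ∈ Φ.target} := by
        have h6 := hline.continuousAt.tendsto
        simp only [zero_smul, add_zero] at h6
        exact h6.eventually (hTopen.mem_nhds hPp)
      filter_upwards [ht] with r hr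
      rw [← hΦ, Φ.right_inv hr]
    have h4 : linOp B ζ = 0 := congrArg Prod.fst h3
    have h5 : P (traj ζ.1.1 0) = l := congrArg Prod.snd h3
    have h6 : evalAt E 0 ζ = l := by
      have h7 := hP ⟨traj ζ.1.1 0, ζ, h4, rfl⟩
      simp only [h5] at h7
      exact (congrArg Subtype.val h7).symm
    rw [← h6]
    have h9 := (evalAt E 0).hasFDerivAt.comp_hasDerivAt (0 : ℝ) hζ
    exact h9

lemma stablePlaque_mono {ε ε' : ℝ} (h : ε ≤ ε') : stablePlaque F e p ε ⊆ stablePlaque F e p ε' :=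
  fun _ ⟨x, y, hx, hy, hxy⟩ => ⟨x, y, hx, hy, fun t ht => (hxy t ht).trans_le h⟩

/-- The **stable manifold theorem** at an equilibrium whose linearization is diagonalizable with
nonzero real eigenvalues: the stable manifold is smooth, its dimension is the number of negative
eigenvalues, and its tangent space at `p` contains the space (of that dimension) of the initial
values of the decaying solutions of the equation linearized along the orbit of `p`. -/
theorem stable_manifold (hF : ContDiff ℝ ∞ F) (he : F e = 0)
    (hμ : ∀ i, μ i ≠ 0) (hv : ∀ i, fderiv ℝ F e (v i) = μ i • v i)
    {x : ℝ → E} (hx : IsConvergingSolution F e p x) :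
    (∀ᶠ ε in 𝓝[>] (0 : ℝ), IsSubmanifold (Nat.card {i // μ i < 0}) (stablePlaque F e p ε)) ∧
    ∃ L : Submodule ℝ E, Module.finrank ℝ L = Nat.card {i // μ i < 0} ∧
      (L : Set E) ⊆ stableTangent F e p ∧
      ∀ ξ, ξ ∈ L ↔ ∃ ζ : ℝ → E, ζ 0 = ξ ∧ Tendsto ζ atTop (𝓝 0) ∧
        ∀ t, 0 ≤ t → HasDerivWithinAt ζ (fderiv ℝ F (x t) (ζ t)) (Ici 0) t := by
  obtain ⟨z, hze, hz⟩ := hx.exists_traj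
  obtain ⟨B, hBz⟩ : ∃ B, B = linearization hF z := ⟨_, rfl⟩
  have hBt : ∀ t, 0 ≤ t → traj B t = fderiv ℝ F (x t) := by
    intro t ht
    rw [hBz, ← hz t ht]; rfl
  have hBtop : B ⊤ = fderiv ℝ F e := by rw [hBz, ← hze]; rfl
  have hB : ∀ i, B ⊤ (v i) = μ i • v i := by rw [hBtop]; exact hv
  obtain ⟨P₀, hP₀⟩ := (decaying B).subtype.exists_leftInverse_of_injective
    (LinearMap.ker_eq_bot.2 (decaying B).subtype_injective)
  set P : E →L[ℝ] decaying B := LinearMap.toContinuousLinearMap P₀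
  have hP : ∀ l : decaying B, P l = l := fun l => LinearMap.congr_fun hP₀ l
  have hdim := finrank_decaying hμ hB
  obtain ⟨s, ε₀, hε₀, hs⟩ := exists_plaque_eq_graph hF he hμ hv hx hze hz hBz hP
  refine ⟨?_, decaying B, hdim, ?_, ?_⟩
  · filter_upwards [Ioc_mem_nhdsGT hε₀] with ε hε
    obtain ⟨O, hO, hsO, hPs, -, -, hplaque, -⟩ := hs ε hε.1 hε.2
    rw [hplaque, ← hdim]
    exact isSubmanifold_graph hP hO hsO hPs
  · intro l hl ε hε
    obtain ⟨O, hO, hsO, hPs, hpO, hsp, hplaque, hder⟩ := hs (min ε ε₀) (lt_min hε hε₀)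
      (min_le_right _ _)
    have hline : ContDiff ℝ ∞ fun r : ℝ => P p + r • (⟨l, hl⟩ : decaying B) := by fun_prop
    have hline0 : P p + (0 : ℝ) • (⟨l, hl⟩ : decaying B) = P p := by simp
    refine ⟨fun r => s (P p + r • ⟨l, hl⟩), ?_, ?_, hder ⟨l, hl⟩, ?_⟩
    · refine ContDiffAt.comp (0 : ℝ) ?_ hline.contDiffAt
      rw [hline0]
      exact hsO.contDiffAt (hO.mem_nhds hpO)
    · simpa using hsp
    · have h1 := hline.continuous.tendsto 0
      rw [hline0] at h1
      filter_upwards [h1.eventually (hO.mem_nhds hpO)] with r hr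
      refine stablePlaque_mono (min_le_left ε ε₀) ?_
      rw [hplaque]
      refine ⟨?_, ?_⟩
      · rw [hPs _ hr]; exact hr
      · rw [hPs _ hr]
  · intro ξ
    rw [mem_decaying]
    constructor
    · rintro ⟨q, hq, hq0⟩
      refine ⟨traj q.1.1, hq0, ?_, fun t ht => ?_⟩
      · have h1 : q.1.1 ⊤ = 0 := by
          have h2 := snd_top_eq_zero q
          rw [sub_eq_zero.1 ((linOp_apply B q).symm.trans hq)] at h2
          refine v.ext_elem fun i => ?_
          have h3 := repr_apply_of_eigen hB (q.1.1 ⊤) i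
          rw [show B ⊤ (q.1.1 ⊤) = 0 from h2] at h3
          simpa [hμ i] using h3
        rw [← h1]
        exact tendsto_traj q.1.1
      · have h1 := hasDerivWithinAt_of_linOp_eq hq ht
        rwa [hBt t ht, traj_zero, add_zero] at h1
    · rintro ⟨ζ, hζ0, hζl, hζ⟩
      obtain ⟨q, hq, hqζ⟩ := exists_linOp_eq (B := B) (g := 0) (y := ζ) (l := 0) (by
        intro t ht
        rw [hBt t ht, traj_zero, add_zero]
        exact hζ t ht) hζl
      exact ⟨q, hq, by rw [hqζ 0 le_rfl, hζ0]⟩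

end StableManifold

/-! ### Eigenvalue counts and dimensions -/

section Indices

set_option linter.unusedSectionVars false

universe u

variable {E : Type u} [NormedAddCommGroup E] [NormedSpace ℝ E] [FiniteDimensional ℝ E]
  {ι : Type*} [Fintype ι] {v : Module.Basis ι ℝ E} {μ : ι → ℝ} {F : E → E} {e p : E}

lemma eigenvaluesAt_eq_map (hv : ∀ i, fderiv ℝ F e (v i) = μ i • v i) :
    eigenvaluesAt F e = Finset.univ.val.map fun i => (μ i : ℂ) := by
  classical
  have h1 : LinearMap.toMatrix v v (fderiv ℝ F e : E →ₗ[ℝ] E) = Matrix.diagonal μ := by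
    ext i j
    rw [LinearMap.toMatrix_apply, ContinuousLinearMap.coe_coe, hv, map_smul, Finsupp.smul_apply,
      v.repr_self, Matrix.diagonal_apply, Finsupp.single_apply]
    by_cases h : i = j
    · simp [h]
    · simp [h, Ne.symm h]
  rw [eigenvaluesAt, ← LinearMap.charpoly_toMatrix _ v, h1, Matrix.charpoly_diagonal,
    Polynomial.aroots_def, Polynomial.map_prod]
  have h2 : (∏ i, Polynomial.map (algebraMap ℝ ℂ) (Polynomial.X - Polynomial.C (μ i)))
      = ((Finset.univ.val.map fun i => (μ i : ℂ)).map
          fun z => Polynomial.X - Polynomial.C z).prod := by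
    rw [Multiset.map_map, Finset.prod_eq_multiset_prod]
    simp
  rw [h2, Polynomial.roots_multiset_prod_X_sub_C]

lemma stableIndex_eq (hv : ∀ i, fderiv ℝ F e (v i) = μ i • v i) :
    stableIndex F e = Nat.card {i // μ i < 0} := by
  classical
  rw [stableIndex, eigenvaluesAt_eq_map hv, Multiset.filter_map, Multiset.card_map,
    Nat.card_eq_fintype_card, Fintype.card_subtype]
  rw [Finset.card_def, Finset.filter_val]
  congr 2

lemma unstableIndex_eq (hv : ∀ i, fderiv ℝ F e (v i) = μ i • v i) :
    unstableIndex F e = Nat.card {i // 0 < μ i} := by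
  classical
  rw [unstableIndex, eigenvaluesAt_eq_map hv, Multiset.filter_map, Multiset.card_map,
    Nat.card_eq_fintype_card, Fintype.card_subtype]
  rw [Finset.card_def, Finset.filter_val]
  congr 2

lemma isHyperbolicEquilibrium_iff (hv : ∀ i, fderiv ℝ F e (v i) = μ i • v i) :
    IsHyperbolicEquilibrium F e ↔ F e = 0 ∧ ∀ i, μ i ≠ 0 := by
  simp [IsHyperbolicEquilibrium, eigenvaluesAt_eq_map hv]

lemma fderiv_neg_eigen (hv : ∀ i, fderiv ℝ F e (v i) = μ i • v i) (i : ι) :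
    fderiv ℝ (fun x => -F x) e (v i) = (-μ i) • v i := by
  rw [fderiv_fun_neg, neg_apply, hv, neg_smul]

lemma stableManifoldHasDim (hF : ContDiff ℝ ∞ F) (he : F e = 0) (hμ : ∀ i, μ i ≠ 0)
    (hv : ∀ i, fderiv ℝ F e (v i) = μ i • v i) :
    StableManifoldHasDim F e (Nat.card {i // μ i < 0}) :=
  fun _ ⟨_, hx⟩ => (stable_manifold hF he hμ hv hx).1

lemma isConvergingSolution_const (he : F e = 0) : IsConvergingSolution F e e fun _ => e :=
  ⟨fun t _ => by simpa [he] using hasDerivWithinAt_const t (Ici 0) e, rfl, tendsto_const_nhds⟩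

lemma IsConvergingSolution.mem_stablePlaque {x : ℝ → E} (hx : IsConvergingSolution F e p x) {ε : ℝ}
    (hε : 0 < ε) : p ∈ stablePlaque F e p ε :=
  ⟨x, x, hx, hx, fun t _ => by rwa [dist_self]⟩

/-- The dimension of the stable manifold is the number of stable eigenvalues. -/
lemma card_eq_of_stableManifoldHasDim (hF : ContDiff ℝ ∞ F) (he : F e = 0) (hμ : ∀ i, μ i ≠ 0)
    (hv : ∀ i, fderiv ℝ F e (v i) = μ i • v i) {k : ℕ} (hk : StableManifoldHasDim F e k) :
    Nat.card {i // μ i < 0} = k := by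
  have hx := isConvergingSolution_const he
  obtain ⟨ε, ⟨h1, h2⟩, hε⟩ := (((stableManifoldHasDim hF he hμ hv e ⟨_, hx⟩).and
    (hk e ⟨_, hx⟩)).and self_mem_nhdsWithin).exists
  exact (h1 e (hx.mem_stablePlaque hε)).dim_unique (h2 e (hx.mem_stablePlaque hε))

lemma isHyperbolicSaddle_of_card_eq (hF : ContDiff ℝ ∞ F) (he : F e = 0) (hμ : ∀ i, μ i ≠ 0)
    (hv : ∀ i, fderiv ℝ F e (v i) = μ i • v i) {k : ℕ} (hk : 0 < k)
    (hs : Nat.card {i // μ i < 0} = k) (hu : Nat.card {i // 0 < μ i} = k) :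
    IsHyperbolicSaddle k F e where
  hyperbolic := (isHyperbolicEquilibrium_iff hv).2 ⟨he, hμ⟩
  pos := hk
  stableIndex_eq := by rw [stableIndex_eq hv, hs]
  unstableIndex_eq := by rw [unstableIndex_eq hv, hu]
  stable_dim := hs ▸ stableManifoldHasDim hF he hμ hv
  unstable_dim := by
    have h1 := stableManifoldHasDim (μ := fun i => -μ i) hF.neg (by simp [he])
      (fun i => neg_ne_zero.2 (hμ i)) (fderiv_neg_eigen hv)
    simp only [neg_lt_zero] at h1
    rwa [hu] at h1

lemma stablePlaque_subset {ε : ℝ} : stablePlaque F e p ε ⊆ stableSet F e :=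
  fun _ ⟨_, y, _, hy, _⟩ => ⟨y, hy⟩

lemma tangentSet_mono {S S' : Set E} (h : S ⊆ S') : tangentSet S p ⊆ tangentSet S' p :=
  fun _ ⟨γ, h1, h2, h3, h4⟩ => ⟨γ, h1, h2, h3, h4.mono fun _ hs => h hs⟩

lemma stableTangent_subset {M : Set E} (h : stableSet F e ⊆ M) :
    stableTangent F e p ⊆ tangentSet M p :=
  fun _ hw => tangentSet_mono (stablePlaque_subset.trans h) (hw 1 one_pos)

/-- A plaque of full dimension is a neighbourhood of its centre. -/
lemma stablePlaque_mem_nhds (hdim : StableManifoldHasDim F e (Module.finrank ℝ E))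
    {x : ℝ → E} (hx : IsConvergingSolution F e p x) {ε : ℝ} (hε : 0 < ε) :
    stablePlaque F e p ε ∈ 𝓝 p := by
  obtain ⟨ε', h1, hε'⟩ := ((hdim p ⟨x, hx⟩).and (Ioc_mem_nhdsGT hε)).exists
  obtain ⟨-, Φ, V, hp, -, -, hV, hS⟩ := h1 p (hx.mem_stablePlaque hε'.1)
  have hVtop : V = ⊤ := Submodule.eq_top_of_finrank_eq hV
  filter_upwards [Φ.open_source.mem_nhds hp] with q hq
  refine stablePlaque_mono hε'.2 ((hS q hq).2 ?_)
  rw [hVtop]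
  exact Submodule.mem_top

end Indices

/-! ### Level sets -/

section LevelSets

set_option linter.unusedSectionVars false

variable {E : Type*} [NormedAddCommGroup E] [NormedSpace ℝ E] [FiniteDimensional ℝ E]

lemma isSubmanifoldAt_levelSet {g : E → ℝ} (hg : ContDiff ℝ ∞ g) {p : E} (hp : g p = 0)
    (hne : fderiv ℝ g p ≠ 0) : IsSubmanifoldAt (Module.finrank ℝ E - 1) (g ⁻¹' {0}) p := by
  set φ := fderiv ℝ g p with hφ
  obtain ⟨w, hw⟩ : ∃ w, φ w = 1 := by
    obtain ⟨w, hw⟩ : ∃ w, φ w ≠ 0 := by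
      by_contra! h
      exact hne (ContinuousLinearMap.ext h)
    exact ⟨(φ w)⁻¹ • w, by simp [hw]⟩
  have hΘ : ContDiff ℝ ∞ fun x => x + (g x - φ x) • w := by fun_prop
  have hΘ' : HasFDerivAt (fun x => x + (g x - φ x) • w) (ContinuousLinearMap.id ℝ E) p := by
    have h1 : HasFDerivAt (fun x => g x - φ x) (φ - φ) p :=
      ((hg.differentiable (by simp) p).hasFDerivAt).sub φ.hasFDerivAt
    refine ((hasFDerivAt_id p).add (h1.smul_const w)).congr_fderiv ?_
    ext x
    simp
  obtain ⟨Φ, hpΦ, hΦ, hΦs⟩ := exists_smooth_localInverse hΘ hΘ' Function.bijective_id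
  have hφ0 : (φ : E →ₗ[ℝ] ℝ) ≠ 0 := fun h => hne (ContinuousLinearMap.ext fun x =>
    LinearMap.congr_fun h x)
  refine ⟨hp, Φ, LinearMap.ker (φ : E →ₗ[ℝ] ℝ), hpΦ, ?_, hΦs, ?_, fun x _ => ?_⟩
  · exact hΘ.contDiffOn.congr fun x _ => hΦ x
  · have := Module.Dual.finrank_ker_add_one_of_ne_zero (f := (φ : E →ₗ[ℝ] ℝ)) hφ0
    omega
  · rw [LinearMap.mem_ker, hΦ]
    simp [hw]

end LevelSets

/-! ### The Euler–Lagrange field of a gradient field -/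

section GradientField

variable {n : ℕ} {f : EuclideanSpace ℝ (Fin n) → EuclideanSpace ℝ (Fin n)}

/-- At a hyperbolic equilibrium of a gradient field there is an eigenbasis with nonzero real
eigenvalues. -/
lemma exists_eigenbasis
    (hsymm : ∀ x, ContinuousLinearMap.adjoint (fderiv ℝ f x) = fderiv ℝ f x)
    {e : EuclideanSpace ℝ (Fin n)} (he : IsHyperbolicEquilibrium f e) :
    ∃ (v : Module.Basis (Fin n) ℝ (EuclideanSpace ℝ (Fin n))) (μ : Fin n → ℝ),
      (∀ i, μ i ≠ 0) ∧ ∀ i, fderiv ℝ f e (v i) = μ i • v i := by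
  have hT : (fderiv ℝ f e : EuclideanSpace ℝ (Fin n) →ₗ[ℝ] _).IsSymmetric :=
    ContinuousLinearMap.isSelfAdjoint_iff_isSymmetric.1
      ((ContinuousLinearMap.star_eq_adjoint _).trans (hsymm e))
  have hv : ∀ i, fderiv ℝ f e ((hT.eigenvectorBasis finrank_euclideanSpace_fin).toBasis i) =
      hT.eigenvalues finrank_euclideanSpace_fin i •
        (hT.eigenvectorBasis finrank_euclideanSpace_fin).toBasis i := by
    intro i
    rw [OrthonormalBasis.coe_toBasis]
    exact hT.apply_eigenvectorBasis finrank_euclideanSpace_fin i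
  exact ⟨_, _, ((isHyperbolicEquilibrium_iff hv).1 he).2, hv⟩

lemma elField_eq (hsymm : ∀ x, ContinuousLinearMap.adjoint (fderiv ℝ f x) = fderiv ℝ f x) :
    elField f = fun p => (-f p.1 + p.2, fderiv ℝ f p.1 p.2) := by
  funext p
  rw [elField, hsymm]

lemma contDiff_elField (hf : ContDiff ℝ ∞ f)
    (hsymm : ∀ x, ContinuousLinearMap.adjoint (fderiv ℝ f x) = fderiv ℝ f x) :
    ContDiff ℝ ∞ (elField f) := by
  rw [elField_eq hsymm]
  have h1 : ContDiff ℝ ∞ (fderiv ℝ f) := hf.fderiv_right (by simp)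
  exact ((hf.comp contDiff_fst).neg.add contDiff_snd).prodMk
    ((h1.comp contDiff_fst).clm_apply contDiff_snd)

/-- On the invariant plane `v = 0` the linearization is block triangular. -/
lemma fderiv_elField_apply (hf : ContDiff ℝ ∞ f)
    (hsymm : ∀ x, ContinuousLinearMap.adjoint (fderiv ℝ f x) = fderiv ℝ f x)
    (u : EuclideanSpace ℝ (Fin n)) (w : EuclideanSpace ℝ (Fin n) × EuclideanSpace ℝ (Fin n)) :
    fderiv ℝ (elField f) (u, 0) w = (-fderiv ℝ f u w.1 + w.2, fderiv ℝ f u w.2) := by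
  rw [elField_eq hsymm]
  have h1 : ContDiff ℝ ∞ (fderiv ℝ f) := hf.fderiv_right (by simp)
  set p : EuclideanSpace ℝ (Fin n) × EuclideanSpace ℝ (Fin n) := (u, 0)
  have hfst : HasFDerivAt (Prod.fst : EuclideanSpace ℝ (Fin n) × EuclideanSpace ℝ (Fin n) → _)
    (ContinuousLinearMap.fst ℝ _ _) p := hasFDerivAt_fst
  have hsnd : HasFDerivAt (Prod.snd : EuclideanSpace ℝ (Fin n) × EuclideanSpace ℝ (Fin n) → _)
    (ContinuousLinearMap.snd ℝ _ _) p := hasFDerivAt_snd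
  have hA : HasFDerivAt (fun q : EuclideanSpace ℝ (Fin n) × EuclideanSpace ℝ (Fin n) => f q.1) _ p :=
    ((hf.differentiable (by simp) u).hasFDerivAt).comp p hfst
  have hB : HasFDerivAt
      (fun q : EuclideanSpace ℝ (Fin n) × EuclideanSpace ℝ (Fin n) => fderiv ℝ f q.1) _ p :=
    ((h1.differentiable (by simp) u).hasFDerivAt).comp p hfst
  have h : HasFDerivAt (fun q : EuclideanSpace ℝ (Fin n) × EuclideanSpace ℝ (Fin n) =>
      (-f q.1 + q.2, fderiv ℝ f q.1 q.2)) _ p := (hA.neg.add hsnd).prodMk (hB.clm_apply hsnd)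
  rw [h.fderiv]
  simp [p]

lemma hasFDerivAt_hamiltonian (hf : ContDiff ℝ ∞ f)
    (p : EuclideanSpace ℝ (Fin n) × EuclideanSpace ℝ (Fin n)) :
    ∃ H' : EuclideanSpace ℝ (Fin n) × EuclideanSpace ℝ (Fin n) →L[ℝ] ℝ,
      HasFDerivAt (hamiltonian f) H' p ∧
      ∀ w, H' w = ⟪p.2, w.2⟫_ℝ - (⟪f p.1, w.2⟫_ℝ + ⟪fderiv ℝ f p.1 w.1, p.2⟫_ℝ) := by
  have hfst : HasFDerivAt (Prod.fst : EuclideanSpace ℝ (Fin n) × EuclideanSpace ℝ (Fin n) → _)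
    (ContinuousLinearMap.fst ℝ _ _) p := hasFDerivAt_fst
  have hsnd : HasFDerivAt (Prod.snd : EuclideanSpace ℝ (Fin n) × EuclideanSpace ℝ (Fin n) → _)
    (ContinuousLinearMap.snd ℝ _ _) p := hasFDerivAt_snd
  have hA : HasFDerivAt (fun q : EuclideanSpace ℝ (Fin n) × EuclideanSpace ℝ (Fin n) => f q.1) _ p :=
    ((hf.differentiable (by simp) p.1).hasFDerivAt).comp p hfst
  have h := (hsnd.norm_sq.mul_const (2 : ℝ)⁻¹).sub (hA.inner ℝ hsnd)
  refine ⟨_, h.congr_of_eventuallyEq (Eventually.of_forall fun q => ?_), fun w => ?_⟩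
  · simp [hamiltonian, div_eq_mul_inv]
  · simp [fderivInnerCLM_apply]

lemma contDiff_hamiltonian (hf : ContDiff ℝ ∞ f) : ContDiff ℝ ∞ (hamiltonian f) :=
  ((contDiff_snd.norm_sq ℝ).div_const 2).sub ((hf.comp contDiff_fst).inner ℝ contDiff_snd)

/-- `H` vanishes along every solution that converges to a point of the form `(e, 0)`, for either
direction of time: it is a constant of motion and continuous. -/
lemma hamiltonian_eq_zero (hf : ContDiff ℝ ∞ f)
    (hsymm : ∀ x, ContinuousLinearMap.adjoint (fderiv ℝ f x) = fderiv ℝ f x) (c : ℝ)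
    {e : EuclideanSpace ℝ (Fin n)} {p : EuclideanSpace ℝ (Fin n) × EuclideanSpace ℝ (Fin n)}
    {x : ℝ → EuclideanSpace ℝ (Fin n) × EuclideanSpace ℝ (Fin n)}
    (hx : IsConvergingSolution (fun q => c • elField f q) (e, 0) p x) : hamiltonian f p = 0 := by
  have hder : ∀ t, 0 ≤ t → HasDerivWithinAt (fun t => hamiltonian f (x t)) 0 (Ici 0) t := by
    intro t ht
    obtain ⟨H', hH', hH'w⟩ := hasFDerivAt_hamiltonian hf (x t)
    refine (hH'.comp_hasDerivWithinAt t (hx.1 t ht)).congr_deriv ?_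
    have hadj : ∀ y z, ⟪fderiv ℝ f (x t).1 y, z⟫_ℝ = ⟪y, fderiv ℝ f (x t).1 z⟫_ℝ := by
      intro y z
      conv_lhs => rw [← hsymm]
      exact ContinuousLinearMap.adjoint_inner_left _ _ _
    rw [map_smul, hH'w, elField_eq hsymm]
    simp only [hadj, inner_add_left, inner_neg_left]
    simp
  have hconst : ∀ t, 0 ≤ t → hamiltonian f (x t) = hamiltonian f p := by
    intro t ht
    have := constant_of_has_deriv_right_zero (a := 0) (b := t)
      (fun s hs => ((hder s hs.1).continuousWithinAt).mono Icc_subset_Ici_self)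
      (fun s hs => (hder s hs.1).mono (Ici_subset_Ici.2 hs.1)) t ⟨ht, le_rfl⟩
    rw [this, hx.2.1]
  have hlim : Tendsto (fun t => hamiltonian f (x t)) atTop (𝓝 (hamiltonian f (e, 0))) :=
    ((contDiff_hamiltonian hf).continuous.tendsto _).comp hx.2.2
  have h0 : hamiltonian f (e, 0) = 0 := by simp [hamiltonian]
  rw [h0] at hlim
  refine tendsto_nhds_unique (tendsto_const_nhds (f := atTop (α := ℝ))) (hlim.congr' ?_)
  filter_upwards [eventually_ge_atTop 0] with t ht using hconst t ht

/-- An eigenbasis `v` of `f_u(e)` yields the eigenbasis `(v, 0)`, `(v / (2 μ), v)` of the linearized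
Euler–Lagrange equation at `(e, 0)`, with eigenvalues `-μ` and `μ`. -/
lemma exists_elField_eigenbasis (hf : ContDiff ℝ ∞ f)
    (hsymm : ∀ x, ContinuousLinearMap.adjoint (fderiv ℝ f x) = fderiv ℝ f x)
    {e : EuclideanSpace ℝ (Fin n)} {v : Module.Basis (Fin n) ℝ (EuclideanSpace ℝ (Fin n))}
    {μ : Fin n → ℝ} (hμ : ∀ i, μ i ≠ 0) (hv : ∀ i, fderiv ℝ f e (v i) = μ i • v i) :
    ∃ V : Module.Basis (Fin n ⊕ Fin n) ℝ (EuclideanSpace ℝ (Fin n) × EuclideanSpace ℝ (Fin n)),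
      ∀ i, fderiv ℝ (elField f) (e, 0) (V i) = Sum.elim (fun i => -μ i) μ i • V i := by
  let S : EuclideanSpace ℝ (Fin n) →ₗ[ℝ] EuclideanSpace ℝ (Fin n) :=
    v.constr ℝ fun i => (2 * μ i)⁻¹ • v i
  have hS : ∀ i, S (v i) = (2 * μ i)⁻¹ • v i := fun i => v.constr_basis ℝ _ i
  let shear : (EuclideanSpace ℝ (Fin n) × EuclideanSpace ℝ (Fin n)) ≃ₗ[ℝ]
      (EuclideanSpace ℝ (Fin n) × EuclideanSpace ℝ (Fin n)) :=
    { toFun := fun p => (p.1 + S p.2, p.2)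
      invFun := fun p => (p.1 - S p.2, p.2)
      left_inv := fun p => by simp
      right_inv := fun p => by simp
      map_add' := fun p q => by
        refine Prod.ext ?_ rfl
        simp only [Prod.fst_add, Prod.snd_add, map_add]
        abel
      map_smul' := fun c p => by
        refine Prod.ext ?_ rfl
        simp }
  refine ⟨(v.prod v).map shear, ?_⟩
  rintro (i | i)
  · have h1 : (v.prod v).map shear (Sum.inl i) = (v i, 0) := by
      simp [shear]
    rw [h1, fderiv_elField_apply hf hsymm]
    simp [hv]
  · have h1 : (v.prod v).map shear (Sum.inr i) = ((2 * μ i)⁻¹ • v i, v i) := by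
      simp [shear, hS]
    rw [h1, fderiv_elField_apply hf hsymm]
    refine Prod.ext ?_ ?_
    · simp only [map_smul, hv, Sum.elim_inr, Prod.smul_mk, smul_smul]
      have h2 : (2 * μ i)⁻¹ * μ i = 1 / 2 := by have := hμ i; field_simp
      have h3 : μ i * (2 * μ i)⁻¹ = 1 / 2 := by have := hμ i; field_simp
      rw [h2, h3]
      module
    · simp [hv]

lemma card_neg_add_card_pos {μ : Fin n → ℝ} (hμ : ∀ i, μ i ≠ 0) :
    Nat.card {i // μ i < 0} + Nat.card {i // 0 < μ i} = n := by
  classical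
  simp only [Nat.card_eq_fintype_card]
  have h := Fintype.card_subtype_compl (fun i => μ i < 0)
  have h1 : Fintype.card {i // ¬ μ i < 0} = Fintype.card {i // 0 < μ i} :=
    Fintype.card_congr (Equiv.subtypeEquivRight fun i => by
      rw [not_lt]; exact ⟨fun h => lt_of_le_of_ne h (hμ i).symm, le_of_lt⟩)
  have h2 := Fintype.card_subtype_le (fun i => μ i < 0)
  rw [h1, Fintype.card_fin] at h
  rw [Fintype.card_fin] at h2
  omega

lemma card_elim_neg {μ : Fin n → ℝ} (hμ : ∀ i, μ i ≠ 0) :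
    Nat.card {i // Sum.elim (fun i => -μ i) μ i < 0} = n := by
  rw [Nat.card_congr (Equiv.subtypeSum (p := fun i => Sum.elim (fun i => -μ i) μ i < 0)),
    Nat.card_sum, add_comm]
  simpa using card_neg_add_card_pos hμ

lemma isHyperbolicSaddle_elField (hn : 0 < n) (hf : ContDiff ℝ ∞ f)
    (hsymm : ∀ x, ContinuousLinearMap.adjoint (fderiv ℝ f x) = fderiv ℝ f x)
    {e : EuclideanSpace ℝ (Fin n)} (he : IsHyperbolicEquilibrium f e) :
    IsHyperbolicSaddle n (elField f) (e, 0) := by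
  obtain ⟨v, μ, hμ, hv⟩ := exists_eigenbasis hsymm he
  obtain ⟨V, hV⟩ := exists_elField_eigenbasis hf hsymm hμ hv
  have hμ' : ∀ i, Sum.elim (fun i => -μ i) μ i ≠ 0 := by
    rintro (i | i) <;> simp [hμ i]
  have hneg := card_elim_neg hμ
  refine isHyperbolicSaddle_of_card_eq (contDiff_elField hf hsymm) ?_ hμ' hV hn hneg ?_
  · simp [elField, he.1]
  · rw [Nat.card_congr (Equiv.subtypeSum (p := fun i => 0 < Sum.elim (fun i => -μ i) μ i)),
      Nat.card_sum]
    simpa using card_neg_add_card_pos hμ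

lemma IsConvergingSolution.neg_elField {e p : EuclideanSpace ℝ (Fin n)}
    {x : ℝ → EuclideanSpace ℝ (Fin n)} (hx : IsConvergingSolution f e p x) :
    IsConvergingSolution (fun q => -elField f q) (e, 0) (p, 0) fun t => (x t, 0) := by
  refine ⟨fun t ht => ?_, by simp [hx.2.1], hx.2.2.prodMk_nhds tendsto_const_nhds⟩
  refine ((hx.1 t ht).prodMk (hasDerivWithinAt_const t (Ici 0) 0)).congr_deriv ?_
  simp [elField]

lemma IsConvergingSolution.elField {e p : EuclideanSpace ℝ (Fin n)}
    {x : ℝ → EuclideanSpace ℝ (Fin n)} (hx : IsConvergingSolution (fun q => -f q) e p x) :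
    IsConvergingSolution (elField f) (e, 0) (p, 0) fun t => (x t, 0) := by
  refine ⟨fun t ht => ?_, by simp [hx.2.1], hx.2.2.prodMk_nhds tendsto_const_nhds⟩
  refine ((hx.1 t ht).prodMk (hasDerivWithinAt_const t (Ici 0) 0)).congr_deriv ?_
  simp [EscapePath.elField]

/-- If `Wˢ(a)` is open, `Wᵘ(a, 0)` contains near its points `(u, 0)` an open piece of the plane
`v = 0`. -/
lemma mk_zero_mem_unstableTangent {a u : EuclideanSpace ℝ (Fin n)}
    (hadim : StableManifoldHasDim f a n) {x : ℝ → EuclideanSpace ℝ (Fin n)}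
    (hx : IsConvergingSolution f a u x) (ξ : EuclideanSpace ℝ (Fin n)) :
    (ξ, 0) ∈ unstableTangent (elField f) (a, 0) (u, 0) := by
  intro ε hε
  have hlin : HasDerivAt (fun r : ℝ => u + r • ξ) ξ 0 := by
    simpa using ((hasDerivAt_id (0 : ℝ)).smul_const ξ).const_add u
  refine ⟨fun r => (u + r • ξ, 0), by fun_prop, by simp,
    hlin.prodMk (hasDerivAt_const _ _), ?_⟩
  have h1 := hlin.continuousAt.tendsto
  simp only [zero_smul, add_zero] at h1
  have h2 : stablePlaque f a u ε ∈ 𝓝 u :=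
    stablePlaque_mem_nhds (by rwa [finrank_euclideanSpace_fin]) hx hε
  filter_upwards [h1.eventually h2] with r hr
  obtain ⟨y, z, hy, hz, hyz⟩ := hr
  refine ⟨_, _, hy.neg_elField, hz.neg_elField, fun t ht => ?_⟩
  rw [Prod.dist_eq, dist_self, max_eq_left dist_nonneg]
  exact hyz t ht

end GradientField

/-! ### Transversality -/

section Transversality

variable {n : ℕ} {f : EuclideanSpace ℝ (Fin n) → EuclideanSpace ℝ (Fin n)}

lemma stableSet_elField_subset (hf : ContDiff ℝ ∞ f)
    (hsymm : ∀ x, ContinuousLinearMap.adjoint (fderiv ℝ f x) = fderiv ℝ f x)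
    (e : EuclideanSpace ℝ (Fin n)) :
    stableSet (elField f) (e, 0) ⊆ hamiltonian f ⁻¹' {0} := by
  rintro p ⟨x, hx⟩
  exact hamiltonian_eq_zero hf hsymm 1 (by simpa using hx)

lemma unstableSet_elField_subset (hf : ContDiff ℝ ∞ f)
    (hsymm : ∀ x, ContinuousLinearMap.adjoint (fderiv ℝ f x) = fderiv ℝ f x)
    (e : EuclideanSpace ℝ (Fin n)) :
    unstableSet (elField f) (e, 0) ⊆ hamiltonian f ⁻¹' {0} := by
  rintro p ⟨x, hx⟩
  exact hamiltonian_eq_zero hf hsymm (-1) (by simpa using hx)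

/-- At a point `(u, 0)` of `Wˢ(b, 0)`, the tangent space of `Wˢ(b, 0)` contains an `n`-dimensional
space which meets the plane `v = 0` in the tangent line of the one-dimensional `Wᵘ(b)`. -/
lemma exists_submodule_stableTangent (hf : ContDiff ℝ ∞ f)
    (hsymm : ∀ x, ContinuousLinearMap.adjoint (fderiv ℝ f x) = fderiv ℝ f x)
    {b u : EuclideanSpace ℝ (Fin n)} (hb : IsHyperbolicEquilibrium f b)
    (hbdim : UnstableManifoldHasDim f b 1) {x : ℝ → EuclideanSpace ℝ (Fin n)}
    (hx : IsConvergingSolution (fun q => -f q) b u x) :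
    ∃ L : Submodule ℝ (EuclideanSpace ℝ (Fin n) × EuclideanSpace ℝ (Fin n)),
      Module.finrank ℝ L = n ∧ (L : Set _) ⊆ stableTangent (elField f) (b, 0) (u, 0) ∧
      Module.finrank ℝ (LinearMap.range (LinearMap.inl ℝ (EuclideanSpace ℝ (Fin n))
        (EuclideanSpace ℝ (Fin n))) ⊓ L : Submodule ℝ _) ≤ 1 := by
  obtain ⟨v, μ, hμ, hv⟩ := exists_eigenbasis hsymm hb
  obtain ⟨V, hV⟩ := exists_elField_eigenbasis hf hsymm hμ hv
  have hμ' : ∀ i, Sum.elim (fun i => -μ i) μ i ≠ 0 := by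
    rintro (i | i) <;> simp [hμ i]
  have hμneg : ∀ i, -μ i ≠ 0 := fun i => neg_ne_zero.2 (hμ i)
  have hnf : (fun q => -f q) b = 0 := by simp [hb.1]
  have hone := card_eq_of_stableManifoldHasDim hf.neg hnf hμneg (fderiv_neg_eigen hv) hbdim
  obtain ⟨-, L₁, hL₁, -, hL₁mem⟩ := stable_manifold hf.neg hnf hμneg (fderiv_neg_eigen hv) hx
  obtain ⟨-, L, hL, hLtan, hLmem⟩ := stable_manifold (contDiff_elField hf hsymm)
    (by simp [elField, hb.1]) hμ' hV hx.elField
  refine ⟨L, hL.trans (card_elim_neg hμ), hLtan, ?_⟩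
  have hsub : LinearMap.range (LinearMap.inl ℝ (EuclideanSpace ℝ (Fin n))
      (EuclideanSpace ℝ (Fin n))) ⊓ L ≤ L₁.map (LinearMap.inl ℝ _ _) := by
    rintro _ ⟨⟨ξ, rfl⟩, hξ⟩
    refine ⟨ξ, ?_, rfl⟩
    obtain ⟨ζ, hζ0, hζl, hζ⟩ := (hLmem _).1 hξ
    simp only [fderiv_elField_apply hf hsymm] at hζ
    -- the second component solves a linear equation and vanishes at time `0`
    have hx' : Continuous fun t => fderiv ℝ f (x (max t 0)) := by
      refine (hf.continuous_fderiv (by simp)).comp ?_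
      have hxc : ContinuousOn x (Ici 0) := fun t ht => (hx.1 t ht).continuousWithinAt
      exact hxc.comp_continuous (by fun_prop) fun t => le_max_right t 0
    have hsnd : ∀ t, 0 ≤ t → (ζ t).2 = 0 := by
      refine linear_ode_unique hx' (fun t ht => ?_) (by rw [hζ0]; rfl)
      rw [max_eq_left ht]
      exact (hζ t ht).snd
    refine (hL₁mem ξ).2 ⟨fun t => (ζ t).1, congrArg Prod.fst hζ0, ?_, fun t ht => ?_⟩
    · exact (continuous_fst.tendsto _).comp hζl
    · have h1 := (hζ t ht).fst
      rw [hsnd t ht, add_zero] at h1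
      rwa [fderiv_fun_neg, neg_apply]
  calc _ ≤ Module.finrank ℝ (L₁.map (LinearMap.inl ℝ (EuclideanSpace ℝ (Fin n))
        (EuclideanSpace ℝ (Fin n)))) := Submodule.finrank_mono hsub
    _ ≤ Module.finrank ℝ L₁ := Submodule.finrank_map_le _ _
    _ = 1 := hL₁.trans hone
    _ ≤ 1 := le_rfl

lemma transverseInside_elField (hf : ContDiff ℝ ∞ f)
    (hsymm : ∀ x, ContinuousLinearMap.adjoint (fderiv ℝ f x) = fderiv ℝ f x)
    {a b u : EuclideanSpace ℝ (Fin n)} (hb : IsHyperbolicEquilibrium f b)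
    (hadim : StableManifoldHasDim f a n) (hbdim : UnstableManifoldHasDim f b 1)
    {x y : ℝ → EuclideanSpace ℝ (Fin n)} (hx : IsConvergingSolution f a u x)
    (hy : IsConvergingSolution (fun q => -f q) b u y) (hu : f u ≠ 0) :
    IsSubmanifoldAt (2 * n - 1) (hamiltonian f ⁻¹' {0}) (u, 0) ∧
      TransverseInside (elField f) (a, 0) (b, 0) (hamiltonian f ⁻¹' {0}) (u, 0) := by
  obtain ⟨H', hH', hH'w⟩ := hasFDerivAt_hamiltonian hf (u, 0)
  have hdim : Module.finrank ℝ (EuclideanSpace ℝ (Fin n) × EuclideanSpace ℝ (Fin n)) = 2 * n := by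
    rw [Module.finrank_prod, finrank_euclideanSpace_fin]; ring
  have hH'0 : H' ≠ 0 := by
    intro h
    have h1 := hH'w (0, f u)
    simp only [h, zero_apply] at h1
    simp at h1
    exact hu h1
  have hsub : IsSubmanifoldAt (2 * n - 1) (hamiltonian f ⁻¹' {0}) (u, 0) := by
    rw [← hdim]
    refine isSubmanifoldAt_levelSet (contDiff_hamiltonian hf) (by simp [hamiltonian]) ?_
    rwa [hH'.fderiv]
  refine ⟨hsub, unstableSet_elField_subset hf hsymm a, stableSet_elField_subset hf hsymm b,
    ⟨_, hx.neg_elField⟩, ⟨_, hy.elField⟩, ?_⟩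
  obtain ⟨L, hLn, hLtan, hL1⟩ := exists_submodule_stableTangent hf hsymm hb hbdim hy
  set W : Submodule ℝ (EuclideanSpace ℝ (Fin n) × EuclideanSpace ℝ (Fin n)) :=
    LinearMap.range (LinearMap.inl ℝ _ _)
  have hWn : Module.finrank ℝ W = n := by
    rw [LinearMap.finrank_range_of_inj LinearMap.inl_injective, finrank_euclideanSpace_fin]
  have hWtan : (W : Set _) ⊆ unstableTangent (elField f) (a, 0) (u, 0) := by
    rintro _ ⟨ξ, rfl⟩
    exact mk_zero_mem_unstableTangent hadim hx ξ
  obtain ⟨K, hKn, hK⟩ := hsub.exists_tangentSet_eq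
  have hT₁ : unstableTangent (elField f) (a, 0) (u, 0) ⊆ K := by
    rw [← hK]
    exact stableTangent_subset (unstableSet_elField_subset hf hsymm a)
  have hT₂ : stableTangent (elField f) (b, 0) (u, 0) ⊆ K := by
    rw [← hK]
    exact stableTangent_subset (stableSet_elField_subset hf hsymm b)
  -- `dim (W + L) = 2n - dim (W ∩ L) ≥ 2n - 1`
  have hsup : W ⊔ L = K := by
    refine Submodule.eq_of_le_of_finrank_le
      (sup_le (hWtan.trans hT₁) (hLtan.trans hT₂)) ?_
    have := Submodule.finrank_sup_add_finrank_inf_eq W L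
    omega
  rw [hK]
  refine Subset.antisymm ?_ ?_
  · rintro _ ⟨p, hp, q, hq, rfl⟩
    exact K.add_mem (hT₁ hp) (hT₂ hq)
  · intro w hw
    rw [SetLike.mem_coe, ← hsup] at hw
    obtain ⟨p, hp, q, hq, rfl⟩ := Submodule.mem_sup.1 hw
    exact ⟨p, hWtan hp, q, hLtan hq, rfl⟩

/-- An equilibrium cannot have both an open stable manifold and a one-dimensional unstable one. -/
lemma ne_of_dims (hf : ContDiff ℝ ∞ f)
    (hsymm : ∀ x, ContinuousLinearMap.adjoint (fderiv ℝ f x) = fderiv ℝ f x)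
    {a b : EuclideanSpace ℝ (Fin n)} (hb : IsHyperbolicEquilibrium f b)
    (hadim : StableManifoldHasDim f a n) (hbdim : UnstableManifoldHasDim f b 1) : a ≠ b := by
  rintro rfl
  obtain ⟨v, μ, hμ, hv⟩ := exists_eigenbasis hsymm hb
  have h1 := card_eq_of_stableManifoldHasDim hf hb.1 hμ hv hadim
  have h2 := card_eq_of_stableManifoldHasDim hf.neg (by simp [hb.1])
    (fun i => neg_ne_zero.2 (hμ i)) (fderiv_neg_eigen hv) hbdim
  have h3 := card_neg_add_card_pos hμ
  simp only [neg_lt_zero] at h2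
  omega

lemma pos_of_unstableManifoldHasDim (hf : ContDiff ℝ ∞ f)
    (hsymm : ∀ x, ContinuousLinearMap.adjoint (fderiv ℝ f x) = fderiv ℝ f x)
    {b : EuclideanSpace ℝ (Fin n)} (hb : IsHyperbolicEquilibrium f b)
    (hbdim : UnstableManifoldHasDim f b 1) : 0 < n := by
  obtain ⟨v, μ, hμ, hv⟩ := exists_eigenbasis hsymm hb
  have h2 := card_eq_of_stableManifoldHasDim hf.neg (by simp [hb.1])
    (fun i => neg_ne_zero.2 (hμ i)) (fderiv_neg_eigen hv) hbdim
  have h3 := card_neg_add_card_pos hμ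
  simp only [neg_lt_zero] at h2
  omega

/-- A solution on `ℝ` whose initial point has a forward orbit converging to `e` converges to `e`
from each of its points. -/
lemma isConvergingSolution_of_mem_stableSet {E : Type*} [NormedAddCommGroup E] [NormedSpace ℝ E]
    [FiniteDimensional ℝ E] {F : E → E} (hF : ContDiff ℝ ∞ F) {h : ℝ → E}
    (hsol : IsIntegralCurve h fun _ => F) {e : E} (h0 : h 0 ∈ stableSet F e) (t : ℝ) :
    IsConvergingSolution F e (h t) fun s => h (s + t) := by
  obtain ⟨x, hx⟩ := h0
  have heq := integralCurve_unique hF hx.1 (hsol.isIntegralCurveOn _) hx.2.1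
  have hlim : Tendsto h atTop (𝓝 e) := by
    refine hx.2.2.congr' ?_
    filter_upwards [eventually_ge_atTop 0] with s hs using heq s hs
  exact ⟨(hsol.comp_add t).isIntegralCurveOn _, by simp,
    hlim.comp (tendsto_atTop_add_const_right _ t tendsto_id)⟩

end Transversality

end EscapePath

theorem lemma2 (n : ℕ)
    (f : EuclideanSpace ℝ (Fin n) → EuclideanSpace ℝ (Fin n))
    (hf : ContDiff ℝ ∞ f)
    (hsymm : ∀ x, ContinuousLinearMap.adjoint (fderiv ℝ f x) = fderiv ℝ f x)
    (a b : EuclideanSpace ℝ (Fin n))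
    (ha : EscapePath.IsHyperbolicEquilibrium f a)
    (hb : EscapePath.IsHyperbolicEquilibrium f b)
    (hadim : EscapePath.StableManifoldHasDim f a n)
    (hbdim : EscapePath.UnstableManifoldHasDim f b 1)
    (h : ℝ → EuclideanSpace ℝ (Fin n))
    (hsol : IsIntegralCurve h (fun _ => f))
    (htrans : EscapePath.TransverseInside f b a Set.univ (h 0)) :
    EscapePath.IsHyperbolicSaddle n (EscapePath.elField f) (a, 0) ∧
    EscapePath.IsHyperbolicSaddle n (EscapePath.elField f) (b, 0) ∧
    IsIntegralCurve
      (fun t => ((h (-t), 0) : EuclideanSpace ℝ (Fin n) × EuclideanSpace ℝ (Fin n)))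
      (fun _ => EscapePath.elField f) ∧
    ∀ t : ℝ,
      EscapePath.IsSubmanifoldAt (2 * n - 1) (EscapePath.hamiltonian f ⁻¹' {0}) (h (-t), 0) ∧
      EscapePath.TransverseInside (EscapePath.elField f) (a, 0) (b, 0)
        (EscapePath.hamiltonian f ⁻¹' {0}) (h (-t), 0) := by
  have hn := EscapePath.pos_of_unstableManifoldHasDim hf hsymm hb hbdim
  have hrev : IsIntegralCurve (fun t => h (-t)) (fun _ q => -f q) := by
    intro t
    have h1 := (hsol (-t)).scomp t (hasDerivAt_neg t)
    simpa [Function.comp_def] using h1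
  refine ⟨EscapePath.isHyperbolicSaddle_elField hn hf hsymm ha,
    EscapePath.isHyperbolicSaddle_elField hn hf hsymm hb, fun t => ?_, fun t => ?_⟩
  · refine ((hrev t).prodMk (hasDerivAt_const t 0)).congr_deriv ?_
    simp [EscapePath.elField]
  · have hx := EscapePath.isConvergingSolution_of_mem_stableSet hf hsol htrans.mem_stable (-t)
    have hy := EscapePath.isConvergingSolution_of_mem_stableSet (F := fun q => -f q) hf.neg hrev
      (by simpa [EscapePath.unstableSet] using htrans.mem_unstable) t
    refine EscapePath.transverseInside_elField hf hsymm hb hadim hbdim hx hy fun h0 => ?_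
    -- if `h(-t)` were an equilibrium, both of its limits `a` and `b` would be equal to it
    have hconst := EscapePath.isConvergingSolution_const h0
    have hconst' := EscapePath.isConvergingSolution_const (F := fun q => -f q) (e := h (-t))
      (by simp [h0])
    have ha' := EscapePath.integralCurve_unique hf hx.1 hconst.1 hx.2.1
    have hb' := EscapePath.integralCurve_unique (F := fun q => -f q) hf.neg hy.1 hconst'.1
      hy.2.1
    have h1 : a = h (-t) := tendsto_nhds_unique hx.2.2 (tendsto_const_nhds.congr'
      (by filter_upwards [eventually_ge_atTop 0] with s hs using (ha' s hs).symm))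
    have h2 : b = h (-t) := tendsto_nhds_unique hy.2.2 (tendsto_const_nhds.congr'
      (by filter_upwards [eventually_ge_atTop 0] with s hs using (hb' s hs).symm))
    exact EscapePath.ne_of_dims hf hsymm hb hadim hbdim (h1.trans h2.symm)
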